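/- All rings are commutative with identity. Let $R$ be a noetherian ring, let $S$ be a ring, and let $f\colon R\to S$ and $g\colon S\to R$ be ring homomorphisms with $g\circ f=\mathrm{id}_R$. Regard $S$-modules as $R$-modules via $f$ and $R$-modules as $S$-modules via $g$. Let $C$ be a semidualizing $R$-module, i.e. $C$ is finitely generated over $R$, $R\cong\operatorname{Hom}_R(C,C)$ as $R$-modules, and $\operatorname{Ext}^i_R(C,C)=0$ for all $i\ge 1$. Assume that 1. $\operatorname{Hom}_R(S,C)\cong S$ as $S$-modules, where $S$ acts on $\operatorname{Hom}_R(S,C)$ by $(s\varphi)(t)=\varphi(st)$; 2. $\operatorname{Ext}^i_R(S,C)=0$ for all $i\ge 1$; 3. $C\cong\ker g$ as $R$-modules. Let $\mathcal I$ be the class of injective $R$-modules and $\mathcal I_C$ the class of $R$-modules isomorphic to $\operatorname{Hom}_R(C,I)$ for some $I\in\mathcal I$. An $R$-module $M$ is *$C$-Gorenstein injective* over $R$ if there is an exact complex of $R$-modules $$X=\cdots\to X_1\to X_0\xrightarrow{\partial_0}X_{-1}\to\cdots$$ with $X_i\in\mathcal I_C$ for $i\ge 1$, $X_j\in\mathcal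 I$ for $j\le 0$, $\operatorname{Hom}_R(A,X)$ exact for every $A\in\mathcal I_C$, and $\ker\partial_0\cong M$. An $S$-module $N$ is *Gorenstein injective* over $S$ if there is an exact complex $Y=\cdots\to Y_1\to Y_0\xrightarrow{\partial_0}Y_{-1}\to\cdots$ of injective $S$-modules with $\operatorname{Hom}_S(U,Y)$ exact for every injective $S$-module $U$ and $\ker\partial_0\cong N$. **Proposition 3.12.** For every $R$-module $M$, $M$ is $C$-Gorenstein injective over $R$ if and only if $M$, regarded as an $S$-module via $g$, is Gorenstein injective over $S$. -/

import Mathlib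

open CategoryTheory

universe u

/-- A finitely generated module `C` over a commutative ring `R` is *semidualizing* if
`R ≅ Hom_R(C, C)` as `R`-modules and `Ext_R^i(C, C) = 0` for all `i ≥ 1`. -/
structure IsSemidualizing (R : Type u) [CommRing R] (C : Type u) [AddCommGroup C] [Module R C] :
    Prop where
  finite : Module.Finite R C
  nonempty_equiv : Nonempty (R ≃ₗ[R] (C →ₗ[R] C))
  ext_eq_zero : ∀ i : ℕ, 1 ≤ i →
    Subsingleton (Abelian.Ext (ModuleCat.of R C) (ModuleCat.of R C) i)

/-- Let `f : R → S` be the structure map of the `R`-algebra `S`, and let `g : S → R` be a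
homomorphism of `R`-algebras, that is, a ring homomorphism with `g ∘ f = id_R`.
The conditions on the retract diagram `(f, g)` and the `R`-module `C`:
* `Hom_R(S, C) ≅ S` as `S`-modules, where `s ∈ S` acts on `φ ∈ Hom_R(S, C)` by
  `(s • φ) t = φ (s * t)`;
* `Ext_R^i(S, C) = 0` for all `i ≥ 1`;
* `C ≅ ker g` as `R`-modules. -/
structure IsDualizingRetract (R : Type u) [CommRing R] (S : Type u) [CommRing S] [Algebra R S]
    (g : S →ₐ[R] R) (C : Type u) [AddCommGroup C] [Module R C] : Prop where
  hom_equiv : ∃ e : (S →ₗ[R] C) ≃+ S,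
    ∀ (s : S) (φ : S →ₗ[R] C), e (φ ∘ₗ LinearMap.mulLeft R s) = s * e φ
  ext_eq_zero : ∀ i : ℕ, 1 ≤ i →
    Subsingleton (Abelian.Ext (ModuleCat.of R S) (ModuleCat.of R C) i)
  ker_equiv : Nonempty (C ≃ₗ[R] RingHom.ker g)

/-- The class of injective `R`-modules. -/
def injectiveModules (R : Type u) [CommRing R] : ObjectProperty (ModuleCat.{u} R) :=
  fun I => Module.Injective R I

/-- The class of `R`-modules isomorphic to `Hom_R(C, I)` for some injective `R`-module `I`. -/
def homInjectiveModules (R : Type u) [CommRing R] (C : Type u) [AddCommGroup C] [Module R C] :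
    ObjectProperty (ModuleCat.{u} R) :=
  fun A => ∃ I : ModuleCat.{u} R, injectiveModules R I ∧ Nonempty (A ≃ₗ[R] (C →ₗ[R] I))

/-- For a class `𝒜` of `R`-modules, a *complete `𝒜ℐ`-resolution* is an exact complex
`⋯ → X₁ → X₀ → X₋₁ → ⋯` of `R`-modules such that `X i` is in `𝒜` for `i ≥ 1`, `X j` is injective
for `j ≤ 0`, and the complex `Hom_R(A, X)` is exact for every `A` in `𝒜`. -/
structure IsCompleteResolution {R : Type u} [CommRing R] (𝒜 : ObjectProperty (ModuleCat.{u} R))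
    (X : ChainComplex (ModuleCat.{u} R) ℤ) : Prop where
  acyclic : X.Acyclic
  mem_of_one_le : ∀ i : ℤ, 1 ≤ i → 𝒜 (X.X i)
  injective_of_le_zero : ∀ j : ℤ, j ≤ 0 → injectiveModules R (X.X j)
  hom_exact : ∀ A : ModuleCat.{u} R, 𝒜 A → ∀ i : ℤ,
    Function.Exact (fun φ : A ⟶ X.X (i + 1) => φ ≫ X.d (i + 1) i)
      (fun φ : A ⟶ X.X i => φ ≫ X.d i (i - 1))

/-- An `R`-module `M` is *`C`-Gorenstein injective* if `M ≅ ker (X₀ → X₋₁)` for some complete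
resolution `X` relative to the class of modules `Hom_R(C, I)` with `I` injective. -/
def IsCGorensteinInjective (R : Type u) [CommRing R] (C : Type u) [AddCommGroup C] [Module R C]
    (M : ModuleCat.{u} R) : Prop :=
  ∃ X : ChainComplex (ModuleCat.{u} R) ℤ, IsCompleteResolution (homInjectiveModules R C) X ∧
    Nonempty (LinearMap.ker (X.d 0 (-1)).hom ≃ₗ[R] M)

/-- An `R`-module `M` is *Gorenstein injective* if `M ≅ ker (X₀ → X₋₁)` for some complete injective
resolution `X`, that is, an exact complex of injective modules such that `Hom_R(I, X)` is exact for
every injective `R`-module `I`. -/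
def IsGorensteinInjective (R : Type u) [CommRing R] (M : ModuleCat.{u} R) : Prop :=
  ∃ X : ChainComplex (ModuleCat.{u} R) ℤ, IsCompleteResolution (injectiveModules R) X ∧
    Nonempty (LinearMap.ker (X.d 0 (-1)).hom ≃ₗ[R] M)

/-! A complete resolution of M is cut at M into a proper left resolution and a proper injective
coresolution (`exists_isCompleteResolution_iff`). Each half is compared over R and over S, for an
arbitrary S-module N (`leftResolved_iff`, `rightResolved_iff`). Only at the end is N specialised to
M, on which g ∘ f = id makes R act as before.

The bridge is X ↦ S ⊗ X for X = Hom(C, J) with J injective. Tensor evaluation and Hom(S, C) ≅ S give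
S ⊗ X ≅ Hom(S, J). So S ⊗ X is S-injective, and every S-injective is a retract of such a module. By
adjunction, Hom_S(S ⊗ X, -) = Hom_R(X, -), so properness against S-injectives and properness against
the modules Hom(C, J) are the same condition.

On the right, properness amounts to vanishing of Ext_R(Hom(C, J), -). S-injectives satisfy this
because Ext(S, C) = 0.

On the left, S ≅ R ⊕ C over R gives S ⊗ X ≅ X ⊕ (C ⊗ X), where C ⊗ X ≅ J. An injective J has a
proper left resolution by modules Hom(C, I), obtained by applying Hom(Hom(-, C), J) to a free
resolution of C. Horseshoe arguments then convert resolutions over one ring into resolutions over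
the other. -/

/-- `a` is the first term of an infinite sequence in which consecutive terms are related by `r`;
stated as membership in some predicate that is closed under taking a successor. -/
def HasChain {α : Type*} (r : α → α → Prop) (a : α) : Prop :=
  ∃ Q : α → Prop, Q a ∧ ∀ x, Q x → ∃ y, r x y ∧ Q y

theorem HasChain.exists_seq {α : Type*} {r : α → α → Prop} {a : α} (h : HasChain r a) :
    ∃ f : ℕ → α, f 0 = a ∧ ∀ n, r (f n) (f (n + 1)) := by
  obtain ⟨Q, ha, hQ⟩ := h
  choose! s hs hs' using hQ
  have key : ∀ n, Q (s^[n] a) := by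
    intro n
    induction n with
    | zero => exact ha
    | succ n ih => rw [Function.iterate_succ_apply']; exact hs' _ ih
  refine ⟨fun n => s^[n] a, rfl, fun n => ?_⟩
  simp only [Function.iterate_succ_apply']
  exact hs _ (key n)

theorem HasChain.exists_step {α : Type*} {r : α → α → Prop} {a : α} (h : HasChain r a) :
    ∃ b, r a b ∧ HasChain r b := by
  obtain ⟨Q, ha, hQ⟩ := h
  obtain ⟨b, hb, hb'⟩ := hQ a ha
  exact ⟨b, hb, Q, hb', hQ⟩

/-! ### Cutting complete resolutions into proper short exact sequences -/

section

variable {R : Type u} [CommRing R]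

/-- A short exact sequence `0 → N' → A → N → 0` that stays exact under `Hom(B, -)` for all `B` in
the class `𝒜`. -/
structure ProperSES (𝒜 : ObjectProperty (ModuleCat.{u} R)) {N' A N : Type u}
    [AddCommGroup N'] [AddCommGroup A] [AddCommGroup N] [Module R N'] [Module R A] [Module R N]
    (i : N' →ₗ[R] A) (p : A →ₗ[R] N) : Prop where
  inj : Function.Injective i
  exact : Function.Exact i p
  surj : Function.Surjective p
  lift : ∀ B : ModuleCat.{u} R, 𝒜 B → ∀ φ : B →ₗ[R] N, ∃ ψ : B →ₗ[R] A, p ∘ₗ ψ = φ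

/-- There is an `𝒜`-proper short exact sequence `0 → N' → A → N → 0` with `A` in `ℬ`. -/
def ProperStep (ℬ 𝒜 : ObjectProperty (ModuleCat.{u} R)) (N' N : ModuleCat.{u} R) : Prop :=
  ∃ (A : ModuleCat.{u} R) (i : N' →ₗ[R] A) (p : A →ₗ[R] N), ℬ A ∧ ProperSES 𝒜 i p

/-- The modules with an `𝒜`-proper exact left resolution by modules in `𝒜`. -/
def LeftResolved (𝒜 : ObjectProperty (ModuleCat.{u} R)) : ObjectProperty (ModuleCat.{u} R) :=
  HasChain (fun N N' => ProperStep 𝒜 𝒜 N' N)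

/-- The modules with an `𝒜`-proper exact injective coresolution. -/
def RightResolved (𝒜 : ObjectProperty (ModuleCat.{u} R)) : ObjectProperty (ModuleCat.{u} R) :=
  HasChain (fun N N' => ProperStep (injectiveModules R) 𝒜 N N')

section transport
variable {𝒜 ℬ : ObjectProperty (ModuleCat.{u} R)} {N' A N L' L : Type u}
    [AddCommGroup N'] [AddCommGroup A] [AddCommGroup N] [Module R N'] [Module R A] [Module R N]
    [AddCommGroup L'] [AddCommGroup L] [Module R L'] [Module R L]
    {i : N' →ₗ[R] A} {p : A →ₗ[R] N}

theorem ProperSES.comp_equiv (h : ProperSES 𝒜 i p) (e' : L' ≃ₗ[R] N') (e : N ≃ₗ[R] L) :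
    ProperSES 𝒜 (i ∘ₗ e'.toLinearMap) (e.toLinearMap ∘ₗ p) where
  inj := h.inj.comp e'.injective
  exact := by
    intro a
    have := h.exact a
    simp only [LinearMap.coe_comp, LinearEquiv.coe_coe, Function.comp_apply,
      LinearEquiv.map_eq_zero_iff, this, Set.mem_range]
    exact ⟨fun ⟨y, hy⟩ => ⟨e'.symm y, by simpa using hy⟩, fun ⟨y, hy⟩ => ⟨_, hy⟩⟩
  surj := e.surjective.comp h.surj
  lift B hB φ := by
    obtain ⟨ψ, hψ⟩ := h.lift B hB (e.symm.toLinearMap ∘ₗ φ)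
    refine ⟨ψ, ?_⟩
    rw [LinearMap.comp_assoc, hψ]
    ext; simp

theorem ProperStep.of_equiv {X' X Y' Y : ModuleCat.{u} R} (h : ProperStep ℬ 𝒜 X' X)
    (e' : Y' ≃ₗ[R] X') (e : X ≃ₗ[R] Y) : ProperStep ℬ 𝒜 Y' Y := by
  obtain ⟨A, i, p, hA, h⟩ := h
  exact ⟨A, _, _, hA, h.comp_equiv e' e⟩

theorem LeftResolved.of_equiv {X Y : ModuleCat.{u} R} (h : LeftResolved 𝒜 X) (e : X ≃ₗ[R] Y) :
    LeftResolved 𝒜 Y := by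
  obtain ⟨X', h, Q, hX, hQ⟩ := HasChain.exists_step h
  refine ⟨fun N => Q N ∨ N = Y, Or.inr rfl, ?_⟩
  rintro N (hN | rfl)
  · obtain ⟨y, hy, hy'⟩ := hQ N hN
    exact ⟨y, hy, Or.inl hy'⟩
  · exact ⟨X', h.of_equiv (LinearEquiv.refl R _) e, Or.inl hX⟩

theorem RightResolved.of_equiv {X Y : ModuleCat.{u} R} (h : RightResolved 𝒜 X) (e : X ≃ₗ[R] Y) :
    RightResolved 𝒜 Y := by
  obtain ⟨X', h, Q, hX, hQ⟩ := HasChain.exists_step h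
  refine ⟨fun N => Q N ∨ N = Y, Or.inr rfl, ?_⟩
  rintro N (hN | rfl)
  · obtain ⟨y, hy, hy'⟩ := hQ N hN
    exact ⟨y, hy, Or.inl hy'⟩
  · exact ⟨X', h.of_equiv e.symm (LinearEquiv.refl R _), Or.inl hX⟩

end transport

section resolution
variable {𝒜 : ObjectProperty (ModuleCat.{u} R)}

theorem IsCompleteResolution.properStep {X : ChainComplex (ModuleCat.{u} R) ℤ}
    (h : IsCompleteResolution 𝒜 X) {i j k : ℤ} (hi : j + 1 = i) (hk : k + 1 = j)
    {ℬ : ObjectProperty (ModuleCat.{u} R)} (hX : ℬ (X.X i)) :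
    ProperStep ℬ 𝒜 (ModuleCat.of R (LinearMap.ker (X.d i j).hom))
      (ModuleCat.of R (LinearMap.ker (X.d j k).hom)) := by
  have hc : ∀ x, (X.d i j).hom x ∈ LinearMap.ker (X.d j k).hom := by
    intro x
    have := X.d_comp_d i j k
    rw [LinearMap.mem_ker, ← LinearMap.comp_apply, ← ModuleCat.hom_comp, this]
    rfl
  refine ⟨X.X i, (LinearMap.ker (X.d i j).hom).subtype,
    (X.d i j).hom.codRestrict _ hc, hX, Subtype.val_injective, ?_, ?_, ?_⟩
  · intro x
    simp [Subtype.ext_iff]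
  · rintro ⟨x, hx⟩
    have := h.acyclic j
    rw [HomologicalComplex.exactAt_iff' X i j k (by simp [← hi]) (by simp [← hk]),
      ShortComplex.moduleCat_exact_iff] at this
    obtain ⟨y, hy⟩ := this x hx
    exact ⟨y, Subtype.ext hy⟩
  · intro B hB φ
    subst hk hi
    have h1 := h.hom_exact B hB (k + 1)
    have h2 := (h1 (ModuleCat.ofHom ((LinearMap.ker (X.d (k+1) k).hom).subtype ∘ₗ φ))).1
    have e : k + 1 - 1 = k := by ring
    rw [e] at h2
    obtain ⟨ψ, hψ⟩ := h2 (by ext x; exact (φ x).2)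
    refine ⟨ψ.hom, ?_⟩
    ext x
    exact congr($(hψ).hom x)

theorem IsCompleteResolution.leftResolved {X : ChainComplex (ModuleCat.{u} R) ℤ}
    (h : IsCompleteResolution 𝒜 X) :
    LeftResolved 𝒜 (ModuleCat.of R (LinearMap.ker (X.d 0 (-1)).hom)) := by
  -- The cycles in degree i ≥ 0 are covered by the term in degree i + 1 ≥ 1, which lies in `𝒜`.
  refine ⟨fun N => ∃ i j : ℤ, j + 1 = i ∧ 0 ≤ i ∧
    N = ModuleCat.of R (LinearMap.ker (X.d i j).hom), ⟨0, -1, by simp, le_rfl, rfl⟩, ?_⟩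
  rintro _ ⟨i, j, hij, hi, rfl⟩
  exact ⟨_, h.properStep rfl hij (h.mem_of_one_le (i + 1) (by lia)),
    i + 1, i, rfl, by lia, rfl⟩

theorem IsCompleteResolution.rightResolved {X : ChainComplex (ModuleCat.{u} R) ℤ}
    (h : IsCompleteResolution 𝒜 X) :
    RightResolved 𝒜 (ModuleCat.of R (LinearMap.ker (X.d 0 (-1)).hom)) := by
  -- The cycles in degree i ≤ 0 embed in the term of degree i, which is injective.
  refine ⟨fun N => ∃ i j : ℤ, j + 1 = i ∧ i ≤ 0 ∧
    N = ModuleCat.of R (LinearMap.ker (X.d i j).hom), ⟨0, -1, by simp, le_rfl, rfl⟩, ?_⟩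
  rintro _ ⟨i, j, rfl, hi, rfl⟩
  exact ⟨_, h.properStep (k := j - 1) rfl (by ring) (h.injective_of_le_zero _ hi),
    j, j - 1, by ring, by lia, rfl⟩

/-- The differential is the splice of `π (i + 1)` with the injection `ι i`, so its kernel is that of
`π (i + 1)`, namely the image of Z (i + 2). Hence the kernel in degree 0 is Z 1. -/
theorem exists_isCompleteResolution_of_properSES (Z Y : ℤ → ModuleCat.{u} R)
    (ι : ∀ i, Z (i + 1) →ₗ[R] Y i) (π : ∀ i, Y i →ₗ[R] Z i)
    (h : ∀ i, ProperSES 𝒜 (ι i) (π i)) (hY : ∀ i, 1 ≤ i → 𝒜 (Y i))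
    (hY' : ∀ i, i ≤ 0 → injectiveModules R (Y i)) :
    ∃ X : ChainComplex (ModuleCat.{u} R) ℤ, IsCompleteResolution 𝒜 X ∧
      Nonempty (LinearMap.ker (X.d 0 (-1)).hom ≃ₗ[R] Z 1) := by
  let d : ∀ i, Y (i + 1) ⟶ Y i := fun i => ModuleCat.ofHom (ι i ∘ₗ π (i + 1))
  have hd : ∀ i, d (i + 1) ≫ d i = 0 := by
    intro i
    ext x
    change ι i (π (i + 1) (ι (i + 1) (π (i + 1 + 1) x))) = 0
    rw [(h (i + 1)).exact.apply_apply_eq_zero, map_zero]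
  have hX : ∀ i, (ChainComplex.of Y d hd).d (i + 1) i = d i := fun i =>
    ChainComplex.of_d _ _ _
  have hzero : ∀ i x, (d i).hom x = 0 ↔ π (i + 1) x = 0 := by
    intro i x
    exact map_eq_zero_iff (ι i) (h i).inj
  refine ⟨ChainComplex.of Y d hd, ⟨?_, hY, hY', ?_⟩, ?_⟩
  · intro i
    obtain ⟨j, rfl⟩ : ∃ j, i = j + 1 := ⟨i - 1, by ring⟩
    rw [HomologicalComplex.exactAt_iff' _ (j + 1 + 1) (j + 1) j (by simp) (by simp),
      ShortComplex.moduleCat_exact_iff]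
    intro (x : Y (j + 1)) hx
    change ((ChainComplex.of Y d hd).d (j + 1) j).hom x = 0 at hx
    change ∃ y, ((ChainComplex.of Y d hd).d (j + 1 + 1) (j + 1)).hom y = x
    rw [hX] at hx ⊢
    replace hx : (d j).hom x = 0 := hx
    rw [hzero, (h (j + 1)).exact] at hx
    obtain ⟨z, rfl⟩ := hx
    obtain ⟨y, rfl⟩ := (h (j + 1 + 1)).surj z
    exact ⟨y, rfl⟩
  · intro B hB i
    obtain ⟨j, rfl⟩ : ∃ j, i = j + 1 := ⟨i - 1, by ring⟩
    have e : j + 1 - 1 = j := by ring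
    rw [e, hX, hX]
    intro φ
    constructor
    · intro hφ
      have h1 : ∀ x, φ.hom x ∈ LinearMap.range (ι (j + 1)) := by
        intro x
        have : (d j).hom (φ.hom x) = 0 := congr($(hφ).hom x)
        rw [hzero, (h (j + 1)).exact] at this
        exact this
      obtain ⟨ψ, hψ⟩ := (h (j + 1 + 1)).lift B hB
        ((LinearEquiv.ofInjective _ (h (j + 1)).inj).symm.toLinearMap ∘ₗ
          φ.hom.codRestrict _ h1)
      refine ⟨ModuleCat.ofHom ψ, ?_⟩
      ext x
      change ι (j + 1) ((π (j + 1 + 1) ∘ₗ ψ) x) = φ.hom x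
      rw [hψ]
      exact congr_arg Subtype.val ((LinearEquiv.ofInjective _ (h (j + 1)).inj).apply_symm_apply
        ⟨φ.hom x, h1 x⟩)
    · rintro ⟨ψ, rfl⟩
      simp only [Category.assoc, hd, Limits.comp_zero]
  · have key : ∀ j a b : ℤ, a = j + 1 → b = j + 1 + 1 →
        Nonempty (LinearMap.ker ((ChainComplex.of Y d hd).d a j).hom ≃ₗ[R] Z b) := by
      rintro j _ _ rfl rfl
      rw [hX]
      refine ⟨(LinearEquiv.ofBijective ((ι (j + 1)).codRestrict (LinearMap.ker (d j).hom) ?_)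
        ⟨?_, ?_⟩).symm⟩
      · intro x
        exact (hzero j _).2 ((h (j + 1)).exact.apply_apply_eq_zero x)
      · intro x y hxy
        exact (h (j + 1)).inj (congr_arg Subtype.val hxy)
      · rintro ⟨x, hx⟩
        obtain ⟨y, hy⟩ := ((h (j + 1)).exact x).1 ((hzero j _).1 hx)
        exact ⟨y, Subtype.ext hy⟩
    exact key (-1) 0 1 (by simp) (by simp)

theorem exists_isCompleteResolution_iff (M : ModuleCat.{u} R) :
    (∃ X : ChainComplex (ModuleCat.{u} R) ℤ, IsCompleteResolution 𝒜 X ∧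
      Nonempty (LinearMap.ker (X.d 0 (-1)).hom ≃ₗ[R] M)) ↔
    LeftResolved 𝒜 M ∧ RightResolved 𝒜 M := by
  constructor
  · rintro ⟨X, hX, ⟨e⟩⟩
    exact ⟨hX.leftResolved.of_equiv e, hX.rightResolved.of_equiv e⟩
  · rintro ⟨hl, hr⟩
    obtain ⟨f, rfl, hf⟩ := hl.exists_seq
    obtain ⟨f', hf0, hf'⟩ := hr.exists_seq
    -- The module itself sits at index 1: left syzygies follow upwards, cosyzygies downwards from
    -- index 0.
    let Z : ℤ → ModuleCat.{u} R := fun i =>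
      if 1 ≤ i then f (i - 1).toNat else f' (1 - i).toNat
    have hZ : ∀ i, 1 ≤ i → ProperStep 𝒜 𝒜 (Z (i + 1)) (Z i) := by
      intro i hi
      obtain ⟨n, rfl⟩ : ∃ n : ℕ, i = n + 1 := ⟨(i - 1).toNat, by lia⟩
      have h1 : Z (n + 1) = f n := by simp [Z]
      have h2 : Z (n + 1 + 1) = f (n + 1) := by
        have : (1 : ℤ) ≤ n + 1 + 1 := by lia
        simp only [Z, this, if_true]
        congr 1
        lia
      rw [h1, h2]
      exact hf n
    have hZ' : ∀ i, i ≤ 0 → ProperStep (injectiveModules R) 𝒜 (Z (i + 1)) (Z i) := by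
      intro i hi
      obtain ⟨n, rfl⟩ : ∃ n : ℕ, i = -n := ⟨(-i).toNat, by lia⟩
      have h1 : Z (-n) = f' (n + 1) := by
        have : ¬ (1 : ℤ) ≤ -n := by lia
        simp only [Z, this, if_false]
        congr 1
        lia
      have h2 : Z (-n + 1) = f' n := by
        rcases Nat.eq_zero_or_pos n with rfl | hn
        · simp [Z, hf0]
        · have : ¬ (1 : ℤ) ≤ -n + 1 := by lia
          simp only [Z, this, if_false]
          congr 1
          lia
      rw [h1, h2]
      exact hf' n
    have key : ∀ i, ∃ (A : ModuleCat.{u} R) (ι : Z (i + 1) →ₗ[R] A) (π : A →ₗ[R] Z i),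
        (1 ≤ i → 𝒜 A) ∧ (i ≤ 0 → injectiveModules R A) ∧ ProperSES 𝒜 ι π := by
      intro i
      rcases le_or_gt 1 i with hi | hi
      · obtain ⟨A, ι, π, hA, h⟩ := hZ i hi
        exact ⟨A, ι, π, fun _ => hA, fun _ => by lia, h⟩
      · obtain ⟨A, ι, π, hA, h⟩ := hZ' i (by lia)
        exact ⟨A, ι, π, fun _ => by lia, fun _ => hA, h⟩
    choose Y ι π hY hY' h using key
    have h1 : Z 1 = f 0 := by simp [Z]
    rw [← h1]
    exact exists_isCompleteResolution_of_properSES Z Y ι π h hY hY'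

end resolution

end

/-! ### Horseshoe lemma and closure of resolved modules under extensions -/

section
variable {R : Type u} [CommRing R] {𝒜 : ObjectProperty (ModuleCat.{u} R)}
  {P L K A B : Type u} [AddCommGroup P] [AddCommGroup L] [AddCommGroup K] [AddCommGroup A]
  [AddCommGroup B] [Module R P] [Module R L] [Module R K] [Module R A] [Module R B]

theorem LinearMap.exists_comp_eq_of_exact {i : P →ₗ[R] L} {p : L →ₗ[R] K}
    (hi : Function.Injective i) (h : Function.Exact i p) (φ : A →ₗ[R] L) (hφ : p ∘ₗ φ = 0) :
    ∃ ψ : A →ₗ[R] P, i ∘ₗ ψ = φ := by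
  have h1 : ∀ x, φ x ∈ LinearMap.range i := fun x => (h _).1 congr($hφ x)
  refine ⟨(LinearEquiv.ofInjective i hi).symm.toLinearMap ∘ₗ φ.codRestrict _ h1, ?_⟩
  ext x
  exact congr_arg Subtype.val ((LinearEquiv.ofInjective i hi).apply_symm_apply ⟨φ x, h1 x⟩)

theorem ProperSES.of_ker {p : L →ₗ[R] K} (hp : Function.Surjective p)
    (h : ∀ B : ModuleCat.{u} R, 𝒜 B → ∀ φ : B →ₗ[R] K, ∃ ψ : B →ₗ[R] L, p ∘ₗ ψ = φ) :
    ProperSES 𝒜 (LinearMap.ker p).subtype p :=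
  ⟨Subtype.val_injective, LinearMap.exact_subtype_ker_map p, hp, h⟩

/-- The kernel in a proper short exact sequence, made explicit. -/
noncomputable def ProperSES.kerEquiv {i : P →ₗ[R] L} {p : L →ₗ[R] K} (h : ProperSES 𝒜 i p) :
    P ≃ₗ[R] LinearMap.ker p :=
  LinearEquiv.ofInjective i h.inj ≪≫ₗ
    LinearEquiv.ofEq _ _ (LinearMap.exact_iff.1 h.exact).symm

theorem ProperSES.of_split {i : P →ₗ[R] L} {p : L →ₗ[R] K} (hi : Function.Injective i)
    (h : Function.Exact i p) {s : K →ₗ[R] L} (hs : p ∘ₗ s = LinearMap.id) :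
    ProperSES 𝒜 i p :=
  ⟨hi, h, fun x => ⟨s x, congr($hs x)⟩, fun _ _ φ => ⟨s ∘ₗ φ, by
    rw [← LinearMap.comp_assoc, hs, LinearMap.id_comp]⟩⟩

theorem LeftResolved.exists_properSES {N : ModuleCat.{u} R} (h : LeftResolved 𝒜 N) :
    ∃ (A : ModuleCat.{u} R) (p : A →ₗ[R] N), 𝒜 A ∧ ProperSES 𝒜 (LinearMap.ker p).subtype p ∧
      LeftResolved 𝒜 (ModuleCat.of R (LinearMap.ker p)) := by
  obtain ⟨N', ⟨A, i, p, hA, hp⟩, h'⟩ := HasChain.exists_step h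
  exact ⟨A, p, hA, ProperSES.of_ker hp.surj hp.lift, LeftResolved.of_equiv h' hp.kerEquiv⟩

/-- To lift a map into L, lift its image in K through `s`. The remaining error lands in P and is
lifted through `q`. -/
theorem ProperSES.horseshoe {i : P →ₗ[R] L} {p : L →ₗ[R] K} (h : ProperSES 𝒜 i p)
    {q : A →ₗ[R] P} (hq : ProperSES 𝒜 (LinearMap.ker q).subtype q)
    {s : B →ₗ[R] K} (hs : ProperSES 𝒜 (LinearMap.ker s).subtype s)
    {t : B →ₗ[R] L} (ht : p ∘ₗ t = s) :
    ProperSES 𝒜 (LinearMap.ker ((i ∘ₗ q).coprod t)).subtype ((i ∘ₗ q).coprod t) ∧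
    ∃ (i' : LinearMap.ker q →ₗ[R] LinearMap.ker ((i ∘ₗ q).coprod t))
      (p' : LinearMap.ker ((i ∘ₗ q).coprod t) →ₗ[R] LinearMap.ker s), ProperSES 𝒜 i' p' := by
  have hpi : ∀ x, p (i x) = 0 := h.exact.apply_apply_eq_zero
  have hpt : ∀ x, p (t x) = s x := fun x => congr($ht x)
  refine ⟨ProperSES.of_ker ?_ ?_, ?_⟩
  · intro l
    obtain ⟨b, hb⟩ := hs.surj (p l)
    obtain ⟨x, hx⟩ := (h.exact (l - t b)).1 (by rw [map_sub, hpt, hb, sub_self])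
    obtain ⟨a, rfl⟩ := hq.surj x
    exact ⟨(a, b), by simp [hx]⟩
  · intro X hX φ
    obtain ⟨ψ, hψ⟩ := hs.lift X hX (p ∘ₗ φ)
    obtain ⟨χ, hχ⟩ := LinearMap.exists_comp_eq_of_exact h.inj h.exact (φ - t ∘ₗ ψ) (by
      rw [LinearMap.comp_sub, ← LinearMap.comp_assoc, ht, hψ, sub_self])
    obtain ⟨ω, rfl⟩ := hq.lift X hX χ
    refine ⟨ω.prod ψ, ?_⟩
    ext x
    have := congr($hχ x)
    simp only [LinearMap.comp_apply, LinearMap.sub_apply] at this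
    simp [this]
  · refine ⟨(LinearMap.inl R A B).restrict (fun x (hx : q x = 0) => ?_),
      (LinearMap.snd R A B).restrict (fun x (hx : i (q x.1) + t x.2 = 0) => ?_), ?_, ?_, ?_, ?_⟩
    · change i (q x) + t 0 = 0
      rw [hx]
      simp
    · have := congr_arg p hx
      rw [map_add, hpi, hpt, zero_add, map_zero] at this
      exact this
    · intro x y hxy
      exact Subtype.ext congr(($hxy).1.1)
    · rintro ⟨⟨a, b⟩, hab⟩
      have hab' : i (q a) + t b = 0 := hab
      constructor
      · intro hb
        obtain rfl : b = 0 := congr_arg Subtype.val hb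
        refine ⟨⟨a, ?_⟩, rfl⟩
        rw [map_zero, add_zero] at hab'
        exact (map_eq_zero_iff i h.inj).1 hab'
      · rintro ⟨x, hx⟩
        exact Subtype.ext congr(($hx).1.2).symm
    · rintro ⟨b, hb⟩
      obtain ⟨x, hx⟩ := (h.exact (t b)).1 ((hpt b).trans hb)
      obtain ⟨a, ha⟩ := hq.surj (-x)
      refine ⟨⟨(a, b), ?_⟩, rfl⟩
      change i (q a) + t b = 0
      rw [ha, map_neg, hx, neg_add_cancel]
    · intro X hX φ
      -- On ker s the map `t` lands in P. Lifting its negative through `q` supplies the missing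
      -- first coordinate.
      obtain ⟨χ, hχ⟩ := LinearMap.exists_comp_eq_of_exact h.inj h.exact
        (-(t ∘ₗ (LinearMap.ker s).subtype ∘ₗ φ)) (by
          rw [LinearMap.comp_neg, ← LinearMap.comp_assoc, ht]
          ext x
          simp)
      obtain ⟨ω, rfl⟩ := hq.lift X hX χ
      refine ⟨(ω.prod ((LinearMap.ker s).subtype ∘ₗ φ)).codRestrict _ (fun x => ?_), ?_⟩
      · have := congr($hχ x)
        simp only [LinearMap.comp_apply, LinearMap.neg_apply] at this
        change i (q (ω x)) + t (φ x) = 0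
        rw [this]
        simp
      · ext x
        rfl

theorem ProperSES.comp {s : L →ₗ[R] K} (hs : ProperSES 𝒜 (LinearMap.ker s).subtype s)
    {w : A →ₗ[R] L} (hw : ProperSES 𝒜 (LinearMap.ker w).subtype w) :
    ProperSES 𝒜 (LinearMap.ker (s ∘ₗ w)).subtype (s ∘ₗ w) ∧
    ∃ (i' : LinearMap.ker w →ₗ[R] LinearMap.ker (s ∘ₗ w))
      (p' : LinearMap.ker (s ∘ₗ w) →ₗ[R] LinearMap.ker s), ProperSES 𝒜 i' p' := by
  refine ⟨ProperSES.of_ker (hs.surj.comp hw.surj) ?_, Submodule.inclusion ?_,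
    w.restrict (fun x hx => hx), ?_, ?_, ?_, ?_⟩
  · intro X hX φ
    obtain ⟨ψ, rfl⟩ := hs.lift X hX φ
    obtain ⟨χ, rfl⟩ := hw.lift X hX ψ
    exact ⟨χ, rfl⟩
  · intro x (hx : w x = 0)
    change s (w x) = 0
    rw [hx, map_zero]
  · exact Submodule.inclusion_injective _
  · rintro ⟨x, hx⟩
    constructor
    · intro h
      exact ⟨⟨x, congr_arg Subtype.val h⟩, rfl⟩
    · rintro ⟨y, hy⟩
      have : y.1 = x := congr_arg Subtype.val hy
      exact Subtype.ext (this ▸ y.2)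
  · rintro ⟨y, hy⟩
    obtain ⟨x, rfl⟩ := hw.surj y
    exact ⟨⟨x, hy⟩, rfl⟩
  · intro X hX φ
    obtain ⟨ψ, hψ⟩ := hw.lift X hX ((LinearMap.ker s).subtype ∘ₗ φ)
    refine ⟨ψ.codRestrict _ (fun x => ?_), ?_⟩
    · have : w (ψ x) = φ x := congr($hψ x)
      change s (w (ψ x)) = 0
      rw [this]
      exact (φ x).2
    · ext x
      exact congr($hψ x)

variable (h𝒜 : ∀ A B : ModuleCat.{u} R, 𝒜 A → 𝒜 B → 𝒜 (ModuleCat.of R (A × B)))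
include h𝒜

theorem LeftResolved.of_properSES {P L K : ModuleCat.{u} R} {i : P →ₗ[R] L} {p : L →ₗ[R] K}
    (h : ProperSES 𝒜 i p) (hP : LeftResolved 𝒜 P) (hK : LeftResolved 𝒜 K) :
    LeftResolved 𝒜 L := by
  refine ⟨fun L => ∃ (P K : ModuleCat.{u} R) (i : P →ₗ[R] L) (p : L →ₗ[R] K),
    ProperSES 𝒜 i p ∧ LeftResolved 𝒜 P ∧ LeftResolved 𝒜 K, ⟨P, K, i, p, h, hP, hK⟩, ?_⟩
  clear h hP hK p i P K L
  rintro L ⟨P, K, i, p, h, hP, hK⟩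
  obtain ⟨A, q, hA, hq, hP'⟩ := hP.exists_properSES
  obtain ⟨B, s, hB, hs, hK'⟩ := hK.exists_properSES
  obtain ⟨t, ht⟩ := h.lift B hB s
  obtain ⟨h1, i', p', h2⟩ := h.horseshoe hq hs ht
  exact ⟨ModuleCat.of R _, ⟨ModuleCat.of R (A × B), _, _, h𝒜 A B hA hB, h1⟩,
    ModuleCat.of R _, ModuleCat.of R _, i', p', h2, hP', hK'⟩

/-- A module with a proper left resolution by modules that are themselves resolved by `𝒜` is
resolved by `𝒜`. -/
theorem LeftResolved.of_chain {N : ModuleCat.{u} R}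
    (h : HasChain (fun N N' => ProperStep (LeftResolved 𝒜) 𝒜 N' N) N) : LeftResolved 𝒜 N := by
  obtain ⟨Q, hN, hQ⟩ := h
  have hQ' : ∀ K, Q K → ∃ (B : ModuleCat.{u} R) (s : B →ₗ[R] K), 𝒜 B ∧
      ProperSES 𝒜 (LinearMap.ker s).subtype s ∧ ∃ (P K' : ModuleCat.{u} R)
        (i : P →ₗ[R] LinearMap.ker s) (p : LinearMap.ker s →ₗ[R] K'),
          ProperSES 𝒜 i p ∧ LeftResolved 𝒜 P ∧ Q K' := by
    intro K hK
    obtain ⟨K', ⟨W, i, p, hW, hp⟩, hK'⟩ := hQ K hK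
    obtain ⟨B, w, hB, hw, hP⟩ := hW.exists_properSES
    obtain ⟨h1, i', p', h2⟩ := (ProperSES.of_ker hp.surj hp.lift).comp hw
    exact ⟨B, p ∘ₗ w, hB, h1, ModuleCat.of R _, K', i', _,
      h2.comp_equiv (LinearEquiv.refl R _) hp.kerEquiv.symm, hP, hK'⟩
  -- The invariant is enlarged to proper extensions of a module in Q by a resolved one. A horseshoe
  -- step yields a kernel filtered by ker q, P₂ and K'. The first two are combined into one resolved
  -- module, so the kernel has the same shape again.
  refine ⟨fun L => Q L ∨ ∃ (P K : ModuleCat.{u} R) (i : P →ₗ[R] L) (p : L →ₗ[R] K),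
    ProperSES 𝒜 i p ∧ LeftResolved 𝒜 P ∧ Q K, Or.inl hN, ?_⟩
  rintro L (hL | ⟨P, K, i, p, h, hP, hK⟩)
  · obtain ⟨B, s, hB, hs, P, K', i, p, h, hP, hK'⟩ := hQ' L hL
    exact ⟨ModuleCat.of R (LinearMap.ker s), ⟨B, _, s, hB, hs⟩,
      Or.inr ⟨P, K', i, p, h, hP, hK'⟩⟩
  · obtain ⟨A, q, hA, hq, hP'⟩ := hP.exists_properSES
    obtain ⟨B, s, hB, hs, P₂, K', i₂, p₂, h₂, hP₂, hK'⟩ := hQ' K hK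
    obtain ⟨t, ht⟩ := h.lift B hB s
    obtain ⟨h1, i', p', h3⟩ := h.horseshoe hq hs ht
    obtain ⟨h4, i₃, p₃, h5⟩ := (ProperSES.of_ker h₂.surj h₂.lift).comp
      (ProperSES.of_ker h3.surj h3.lift)
    refine ⟨ModuleCat.of R _, ⟨ModuleCat.of R (A × B), _, _, h𝒜 A B hA hB, h1⟩,
      Or.inr ⟨ModuleCat.of R (LinearMap.ker (p₂ ∘ₗ p')), K', _, _, h4.comp_equiv
        (LinearEquiv.refl R _) (LinearEquiv.refl R _), ?_, hK'⟩⟩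
    exact LeftResolved.of_properSES h𝒜 (P := ModuleCat.of R (LinearMap.ker p'))
      (K := ModuleCat.of R (LinearMap.ker p₂)) h5 (hP'.of_equiv h3.kerEquiv)
      (hP₂.of_equiv h₂.kerEquiv)

end

/-! ### Ext vanishing and proper injective coresolutions -/

section
variable {R : Type u} [CommRing R]

theorem exists_injective_embedding (M : Type u) [AddCommGroup M] [Module R M] :
    ∃ (E : ModuleCat.{u} R) (j : M →ₗ[R] E), Module.Injective R E ∧ Function.Injective j := by
  refine ⟨Injective.under (ModuleCat.of R M), (Injective.ι (ModuleCat.of R M)).hom, ?_, ?_⟩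
  · rw [Module.injective_iff_injective_object]
    exact inferInstanceAs (Injective (Injective.under (ModuleCat.of R M)))
  · exact (ModuleCat.mono_iff_injective _).1 inferInstance

/-- `Ext_R^i(X, Y) = 0` for all `i ≥ 1`. -/
def ExtVanish (R : Type u) [CommRing R] (X Y : Type u) [AddCommGroup X] [Module R X]
    [AddCommGroup Y] [Module R Y] : Prop :=
  ∀ i : ℕ, 1 ≤ i → Subsingleton (Abelian.Ext (ModuleCat.of R X) (ModuleCat.of R Y) i)

variable {X Y X' Y' : Type u} [AddCommGroup X] [Module R X] [AddCommGroup Y] [Module R Y]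
  [AddCommGroup X'] [Module R X'] [AddCommGroup Y'] [Module R Y']

theorem ExtVanish.retract_right (h : ExtVanish R X Y') (s : Y →ₗ[R] Y') (r : Y' →ₗ[R] Y)
    (hrs : r ∘ₗ s = LinearMap.id) : ExtVanish R X Y := by
  intro i hi
  have := h i hi
  refine subsingleton_of_forall_eq 0 fun e => ?_
  have h1 : e.comp (Abelian.Ext.mk₀ (ModuleCat.ofHom s)) (add_zero i) = 0 := Subsingleton.elim _ _
  have h2 := congr(($h1).comp (Abelian.Ext.mk₀ (ModuleCat.ofHom r)) (add_zero i))
  rw [Abelian.Ext.comp_assoc_of_third_deg_zero, Abelian.Ext.mk₀_comp_mk₀, ← ModuleCat.ofHom_comp,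
    hrs, Abelian.Ext.zero_comp] at h2
  simpa using h2

theorem ExtVanish.retract_left (h : ExtVanish R X' Y) (s : X →ₗ[R] X') (r : X' →ₗ[R] X)
    (hrs : r ∘ₗ s = LinearMap.id) : ExtVanish R X Y := by
  intro i hi
  have := h i hi
  refine subsingleton_of_forall_eq 0 fun e => ?_
  have h1 : (Abelian.Ext.mk₀ (ModuleCat.ofHom r)).comp e (zero_add i) = 0 := Subsingleton.elim _ _
  have h2 := congr((Abelian.Ext.mk₀ (ModuleCat.ofHom s)).comp ($h1) (zero_add i))
  rw [Abelian.Ext.mk₀_comp_mk₀_assoc, ← ModuleCat.ofHom_comp,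
    hrs, Abelian.Ext.comp_zero] at h2
  simpa using h2

theorem ExtVanish.congr_right (h : ExtVanish R X Y') (e : Y' ≃ₗ[R] Y) : ExtVanish R X Y :=
  h.retract_right e.symm e (by ext; simp)

theorem ExtVanish.congr_left (h : ExtVanish R X' Y) (e : X' ≃ₗ[R] X) : ExtVanish R X Y :=
  h.retract_left e.symm e (by ext; simp)

theorem ExtVanish.of_injective [Module.Injective R Y] : ExtVanish R X Y := by
  intro i hi
  obtain ⟨n, rfl⟩ := Nat.exists_eq_add_of_le' hi
  have := Module.injective_object_of_injective_module R Y
  exact Abelian.Ext.subsingleton_of_injective _ _ _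

theorem ExtVanish.of_projective [Module.Projective R X] : ExtVanish R X Y := by
  intro i hi
  obtain ⟨n, rfl⟩ := Nat.exists_eq_add_of_le' hi
  have : Projective (ModuleCat.of R X) := (ModuleCat.of R X).projective_of_categoryTheory_projective
  exact Abelian.Ext.subsingleton_of_projective _ _ _

variable {K L N : Type u} [AddCommGroup K] [AddCommGroup L] [AddCommGroup N]
  [Module R K] [Module R L] [Module R N] {f : K →ₗ[R] L} {g : L →ₗ[R] N}

theorem exists_shortExact (hf : Function.Injective f) (hfg : Function.Exact f g)
    (hg : Function.Surjective g) :
    ∃ w, (ShortComplex.mk (ModuleCat.ofHom f) (ModuleCat.ofHom g) w).ShortExact := by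
  refine ⟨by rw [← ModuleCat.ofHom_comp, hfg.linearMap_comp_eq_zero]; rfl, ?_⟩
  exact ModuleCat.shortComplex_shortExact _ hfg hf hg

variable (hf : Function.Injective f) (hfg : Function.Exact f g) (hg : Function.Surjective g)
include hf hfg hg

theorem ExtVanish.left (hL : ExtVanish R L Y) (hN : ExtVanish R N Y) : ExtVanish R K Y := by
  obtain ⟨w, hS⟩ := exists_shortExact hf hfg hg
  intro i hi
  have := hL i hi
  have := hN (1 + i) (by lia)
  refine subsingleton_of_forall_eq 0 fun e => ?_
  obtain ⟨x, rfl⟩ := Abelian.Ext.contravariant_sequence_exact₁ hS _ e rfl (Subsingleton.elim _ _)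
  have := Subsingleton.elim x 0
  rw [this, Abelian.Ext.comp_zero]

theorem ExtVanish.exists_extend (hN : ExtVanish R N Y) (φ : K →ₗ[R] Y) :
    ∃ ψ : L →ₗ[R] Y, ψ ∘ₗ f = φ := by
  obtain ⟨w, hS⟩ := exists_shortExact hf hfg hg
  have := hN (1 + 0) (by lia)
  obtain ⟨x, hx⟩ := Abelian.Ext.contravariant_sequence_exact₁ hS _
    (Abelian.Ext.mk₀ (ModuleCat.ofHom φ)) rfl (Subsingleton.elim _ _)
  obtain ⟨ψ, rfl⟩ : ∃ ψ, Abelian.Ext.mk₀ ψ = x := ⟨_, Abelian.Ext.mk₀_homEquiv₀_apply x⟩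
  rw [Abelian.Ext.mk₀_comp_mk₀] at hx
  have := Abelian.Ext.homEquiv₀.symm.injective hx
  exact ⟨ψ.hom, congr(($this).hom)⟩

theorem ExtVanish.middle_left (hK : ExtVanish R K Y) (hN : ExtVanish R N Y) :
    ExtVanish R L Y := by
  obtain ⟨w, hS⟩ := exists_shortExact hf hfg hg
  intro i hi
  have := hK i hi
  have := hN i hi
  refine subsingleton_of_forall_eq 0 fun e => ?_
  obtain ⟨x, rfl⟩ := Abelian.Ext.contravariant_sequence_exact₂ hS _ e (Subsingleton.elim _ _)
  have := Subsingleton.elim x 0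
  rw [this, Abelian.Ext.comp_zero]

theorem ExtVanish.right (hK : ExtVanish R K Y) (hL : ExtVanish R L Y)
    (h : ∀ φ : K →ₗ[R] Y, ∃ ψ : L →ₗ[R] Y, ψ ∘ₗ f = φ) : ExtVanish R N Y := by
  obtain ⟨w, hS⟩ := exists_shortExact hf hfg hg
  intro i hi
  obtain ⟨n, rfl⟩ := Nat.exists_eq_add_of_le hi
  have := hL _ hi
  refine subsingleton_of_forall_eq 0 fun e => ?_
  obtain ⟨x, rfl⟩ := Abelian.Ext.contravariant_sequence_exact₃ hS _ e (Subsingleton.elim _ _) rfl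
  -- In degree 1 the connecting map from Hom(K, Y) is zero because every map extends to L; in higher
  -- degrees its source vanishes.
  rcases Nat.eq_zero_or_pos n with rfl | hn
  · obtain ⟨φ, rfl⟩ : ∃ φ, Abelian.Ext.mk₀ φ = x := ⟨_, Abelian.Ext.mk₀_homEquiv₀_apply x⟩
    obtain ⟨ψ, hψ⟩ := h φ.hom
    have h2 : φ = ModuleCat.ofHom f ≫ ModuleCat.ofHom ψ := by
      ext x
      exact congr($(hψ.symm) x)
    rw [h2, ← Abelian.Ext.mk₀_comp_mk₀]
    have := hS.extClass_comp
    rw [← Abelian.Ext.comp_assoc_of_second_deg_zero]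
    erw [this]
    simp
  · have := hK n hn
    have := Subsingleton.elim x 0
    rw [this, Abelian.Ext.comp_zero]

theorem ExtVanish.cosyzygy (hK : ExtVanish R X K) (hL : ExtVanish R X L) : ExtVanish R X N := by
  obtain ⟨w, hS⟩ := exists_shortExact hf hfg hg
  intro i hi
  have := hL i hi
  have := hK (i + 1) (by lia)
  refine subsingleton_of_forall_eq 0 fun e => ?_
  obtain ⟨x, rfl⟩ := Abelian.Ext.covariant_sequence_exact₃ _ hS e rfl (Subsingleton.elim _ _)
  have := Subsingleton.elim x 0
  rw [this, Abelian.Ext.zero_comp]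

theorem exists_lift_of_subsingleton_ext
    (hK : Subsingleton (Abelian.Ext (ModuleCat.of R X) (ModuleCat.of R K) 1)) (φ : X →ₗ[R] N) :
    ∃ ψ : X →ₗ[R] L, g ∘ₗ ψ = φ := by
  obtain ⟨w, hS⟩ := exists_shortExact hf hfg hg
  obtain ⟨x, hx⟩ := Abelian.Ext.covariant_sequence_exact₃ _ hS
    (Abelian.Ext.mk₀ (ModuleCat.ofHom φ)) rfl (Subsingleton.elim (h := hK) _ _)
  obtain ⟨ψ, rfl⟩ : ∃ ψ, Abelian.Ext.mk₀ ψ = x := ⟨_, Abelian.Ext.mk₀_homEquiv₀_apply x⟩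
  rw [Abelian.Ext.mk₀_comp_mk₀] at hx
  have := Abelian.Ext.homEquiv₀.symm.injective hx
  exact ⟨ψ.hom, congr(($this).hom)⟩

theorem subsingleton_ext_one_of_lift (hL : ExtVanish R X L)
    (h : ∀ φ : X →ₗ[R] N, ∃ ψ : X →ₗ[R] L, g ∘ₗ ψ = φ) :
    Subsingleton (Abelian.Ext (ModuleCat.of R X) (ModuleCat.of R K) 1) := by
  obtain ⟨w, hS⟩ := exists_shortExact hf hfg hg
  have := hL 1 le_rfl
  refine subsingleton_of_forall_eq 0 fun e => ?_
  obtain ⟨x, rfl⟩ := Abelian.Ext.covariant_sequence_exact₁ _ hS e (Subsingleton.elim _ _)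
    (zero_add 1)
  obtain ⟨φ, rfl⟩ : ∃ φ, Abelian.Ext.mk₀ φ = x := ⟨_, Abelian.Ext.mk₀_homEquiv₀_apply x⟩
  obtain ⟨ψ, hψ⟩ := h φ.hom
  have h2 : φ = ModuleCat.ofHom ψ ≫ ModuleCat.ofHom g := by
    ext x
    exact congr($(hψ.symm) x)
  rw [h2, ← Abelian.Ext.mk₀_comp_mk₀, Abelian.Ext.comp_assoc_of_second_deg_zero]
  have := hS.comp_extClass
  erw [this]
  simp

theorem subsingleton_ext_succ (hL : ExtVanish R X L) {n : ℕ}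
    (hN : Subsingleton (Abelian.Ext (ModuleCat.of R X) (ModuleCat.of R N) n)) :
    Subsingleton (Abelian.Ext (ModuleCat.of R X) (ModuleCat.of R K) (n + 1)) := by
  obtain ⟨w, hS⟩ := exists_shortExact hf hfg hg
  have := hL (n + 1) (by lia)
  refine subsingleton_of_forall_eq 0 fun e => ?_
  obtain ⟨x, rfl⟩ := Abelian.Ext.covariant_sequence_exact₁ _ hS e (Subsingleton.elim _ _) rfl
  have := Subsingleton.elim (h := hN) x 0
  rw [this, Abelian.Ext.zero_comp]

omit hf hfg hg

variable {𝒜 ℬ : ObjectProperty (ModuleCat.{u} R)}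

/-- Properness of the first step kills Ext¹. Higher degrees follow by dimension shifting, so the
induction runs over all members of the chain at once. -/
theorem extVanish_of_hasChain (hℬ : ∀ E, ℬ E → ∀ X, 𝒜 X → ExtVanish R X E)
    {N : ModuleCat.{u} R} (h : HasChain (ProperStep ℬ 𝒜) N) {X : ModuleCat.{u} R} (hX : 𝒜 X) :
    ExtVanish R X N := by
  obtain ⟨Q, hN, hQ⟩ := h
  have key : ∀ n : ℕ, ∀ N, Q N →
      Subsingleton (Abelian.Ext (ModuleCat.of R X) (ModuleCat.of R N) (n + 1)) := by
    intro n
    induction n with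
    | zero =>
      intro N hN
      obtain ⟨N', ⟨E, i, p, hE, hp⟩, hN'⟩ := hQ N hN
      exact subsingleton_ext_one_of_lift hp.inj hp.exact hp.surj (hℬ E hE X hX) (hp.lift X hX)
    | succ n ih =>
      intro N hN
      obtain ⟨N', ⟨E, i, p, hE, hp⟩, hN'⟩ := hQ N hN
      exact subsingleton_ext_succ hp.inj hp.exact hp.surj (hℬ E hE X hX) (ih N' hN')
  intro i hi
  obtain ⟨n, rfl⟩ := Nat.exists_eq_add_of_le' hi
  exact key n N hN

/-- Once Ext vanishes, any embedding into an injective is proper and its cokernel inherits the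
vanishing, so the construction repeats. -/
theorem rightResolved_iff_extVanish {N : ModuleCat.{u} R} :
    RightResolved 𝒜 N ↔ ∀ X, 𝒜 X → ExtVanish R X N := by
  constructor
  · intro h X hX
    refine extVanish_of_hasChain (fun E hE X hX => ?_) h hX
    have : Module.Injective R E := hE
    exact ExtVanish.of_injective
  · intro h
    refine ⟨fun N => ∀ X, 𝒜 X → ExtVanish R X N, h, ?_⟩
    intro N hN
    obtain ⟨E, j, hE, hj⟩ := exists_injective_embedding (R := R) N
    have hex : Function.Exact j (LinearMap.range j).mkQ := LinearMap.exact_map_mkQ_range j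
    refine ⟨ModuleCat.of R (E ⧸ LinearMap.range j), ⟨E, j, (LinearMap.range j).mkQ, hE, hj, hex,
      Submodule.mkQ_surjective _, fun B hB φ => ?_⟩, fun X hX => ?_⟩
    · exact exists_lift_of_subsingleton_ext hj hex (Submodule.mkQ_surjective _) (hN B hB 1 le_rfl) φ
    · exact (hN X hX).cosyzygy hj hex (Submodule.mkQ_surjective _) ExtVanish.of_injective

end

/-! ### Tensor evaluation -/

section
variable {R : Type u} [CommRing R] {C : Type u} [AddCommGroup C] [Module R C]

theorem lcomp_exact {K F D : Type u} [AddCommGroup K] [Module R K] [AddCommGroup D] [Module R D]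
    [AddCommGroup F] [Module R F] {f : K →ₗ[R] F} {g : F →ₗ[R] D} (hfg : Function.Exact f g)
    (hg : Function.Surjective g) : Function.Exact (g.lcomp R C) (f.lcomp R C) := by
  intro φ
  constructor
  · intro hφ
    refine ⟨(LinearMap.ker g).liftQ φ ?_ ∘ₗ (g.quotKerEquivOfSurjective hg).symm.toLinearMap, ?_⟩
    · intro x hx
      obtain ⟨y, rfl⟩ := (hfg x).1 hx
      exact congr($hφ y)
    · ext x
      have : (g.quotKerEquivOfSurjective hg).symm (g x) = Submodule.Quotient.mk x := by
        rw [LinearEquiv.symm_apply_eq]; rfl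
      simp [this]
  · rintro ⟨ψ, rfl⟩
    ext x
    change ψ (g (f x)) = 0
    rw [hfg.apply_apply_eq_zero, map_zero]

theorem lcomp_injective {F D : Type u} [AddCommGroup D] [Module R D]
    [AddCommGroup F] [Module R F] {g : F →ₗ[R] D} (hg : Function.Surjective g) :
    Function.Injective (g.lcomp R C) := by
  intro a b hab
  ext x
  obtain ⟨y, rfl⟩ := hg x
  exact congr($hab y)

end

section
open TensorProduct
variable (R : Type u) [CommRing R] (C J E F : Type u) [AddCommGroup C] [Module R C]
  [AddCommGroup J] [Module R J] [AddCommGroup E] [Module R E] [AddCommGroup F] [Module R F]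

/-- The evaluation map `E ⊗ Hom(C, J) → Hom(Hom(E, C), J)`. -/
noncomputable def homEval : E ⊗[R] (C →ₗ[R] J) →ₗ[R] ((E →ₗ[R] C) →ₗ[R] J) :=
  TensorProduct.lift (LinearMap.mk₂ R (fun e x => x ∘ₗ LinearMap.applyₗ e)
    (fun _ _ _ => by ext; simp) (fun _ _ _ => by ext; simp) (fun _ _ _ => by ext; simp)
    (fun _ _ _ => by ext; simp))

variable {R C J E F}

@[simp]
theorem homEval_tmul (e : E) (x : C →ₗ[R] J) (ψ : E →ₗ[R] C) :
    homEval R C J E (e ⊗ₜ x) ψ = x (ψ e) := rfl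

theorem homEval_rTensor (f : E →ₗ[R] F) (t : E ⊗[R] (C →ₗ[R] J)) (ψ : F →ₗ[R] C) :
    homEval R C J F (f.rTensor _ t) ψ = homEval R C J E t (ψ ∘ₗ f) := by
  induction t using TensorProduct.induction_on with
  | zero => simp
  | tmul e x => simp
  | add a b ha hb => simp only [map_add, LinearMap.add_apply, ha, hb]

theorem homEval_pi_bijective (n : ℕ) : Function.Bijective (homEval R C J (Fin n → R)) := by
  have hrep : ∀ t : (Fin n → R) ⊗[R] (C →ₗ[R] J),
      ∃ x : Fin n → (C →ₗ[R] J), t = ∑ j, Pi.single j 1 ⊗ₜ x j := by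
    intro t
    induction t using TensorProduct.induction_on with
    | zero => exact ⟨0, by simp⟩
    | tmul e x =>
      refine ⟨fun j => e j • x, ?_⟩
      conv_lhs => rw [pi_eq_sum_univ' e, TensorProduct.sum_tmul]
      simp [TensorProduct.smul_tmul]
    | add a b ha hb =>
      obtain ⟨x, rfl⟩ := ha
      obtain ⟨y, rfl⟩ := hb
      exact ⟨x + y, by simp [TensorProduct.tmul_add, Finset.sum_add_distrib]⟩
  constructor
  · rw [← LinearMap.ker_eq_bot, LinearMap.ker_eq_bot']
    intro t ht
    obtain ⟨x, rfl⟩ := hrep t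
    refine Finset.sum_eq_zero fun j _ => ?_
    suffices x j = 0 by rw [this, TensorProduct.tmul_zero]
    ext c
    have := congr($ht ((LinearMap.proj j : (Fin n → R) →ₗ[R] R).smulRight c))
    simpa [Pi.single_apply, apply_ite] using this
  · intro φ
    refine ⟨∑ j, Pi.single j 1 ⊗ₜ (φ ∘ₗ LinearMap.smulRightₗ (LinearMap.proj j)), ?_⟩
    ext ψ
    have : ψ = ∑ j, (LinearMap.proj j : (Fin n → R) →ₗ[R] R).smulRight (ψ (Pi.single j 1)) := by
      ext k
      simp [Pi.single_apply]
    conv_rhs => rw [this]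
    simp

theorem exists_extend_of_ker_le [Module.Injective R J] (f : E →ₗ[R] F) (φ : E →ₗ[R] J)
    (h : LinearMap.ker f ≤ LinearMap.ker φ) : ∃ ψ : F →ₗ[R] J, ψ ∘ₗ f = φ := by
  obtain ⟨ψ, hψ⟩ := Module.Injective.extension_property R J _ _
    ((LinearMap.ker f).liftQ f le_rfl)
    (LinearMap.ker_eq_bot.1 (Submodule.ker_liftQ_eq_bot _ _ _ le_rfl))
    ((LinearMap.ker f).liftQ φ h)
  refine ⟨ψ, ?_⟩
  ext x
  exact congr($hψ (Submodule.Quotient.mk x))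

/-- Hom(E, C) embeds in Hom(Rⁿ, C), so injectivity of J reduces the claim to the free case. -/
theorem homEval_surjective [Module.Finite R E] [Module.Injective R J] :
    Function.Surjective (homEval R C J E) := by
  obtain ⟨n, π, hπ⟩ := Module.Finite.exists_fin' R E
  intro φ
  obtain ⟨ψ, hψ⟩ := exists_extend_of_ker_le (π.lcomp R C) φ (by
    rw [LinearMap.ker_eq_bot.2 (lcomp_injective hπ)]
    exact bot_le)
  obtain ⟨t, rfl⟩ := (homEval_pi_bijective n).2 ψ
  refine ⟨π.rTensor _ t, ?_⟩
  ext x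
  rw [homEval_rTensor, ← hψ]
  rfl

/-- A lift to Rⁿ of an element killed by evaluation defines a functional vanishing on maps that
factor through `π`. It therefore comes from Hom(ker π, C). As ker π is finitely generated,
surjectivity there shows that the lift comes from ker π, hence dies in E. -/
theorem homEval_bijective [IsNoetherianRing R] [Module.Finite R E] [Module.Injective R J] :
    Function.Bijective (homEval R C J E) := by
  refine ⟨?_, homEval_surjective⟩
  obtain ⟨n, π, hπ⟩ := Module.Finite.exists_fin' R E
  rw [← LinearMap.ker_eq_bot, LinearMap.ker_eq_bot']
  intro t ht
  obtain ⟨t, rfl⟩ := LinearMap.rTensor_surjective _ hπ t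
  obtain ⟨ψ, hψ⟩ := exists_extend_of_ker_le ((LinearMap.ker π).subtype.lcomp R C)
    (homEval R C J _ t) (by
      intro χ hχ
      obtain ⟨ω, rfl⟩ := (lcomp_exact (LinearMap.exact_subtype_ker_map π) hπ χ).1 hχ
      rw [LinearMap.mem_ker, LinearMap.lcomp_apply', ← homEval_rTensor, ht, LinearMap.zero_apply])
  obtain ⟨t', rfl⟩ := homEval_surjective (R := R) ψ
  obtain rfl : (LinearMap.ker π).subtype.rTensor _ t' = t := by
    apply (homEval_pi_bijective n).1
    rw [← hψ]
    ext χ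
    rw [homEval_rTensor]
    rfl
  rw [← LinearMap.comp_apply, ← LinearMap.rTensor_comp,
    (LinearMap.exact_subtype_ker_map π).linearMap_comp_eq_zero]
  simp

/-- Evaluation turns the map into the dual of Hom(F, C) → Hom(E, C), which is surjective by
assumption. F need not be finitely generated. -/
theorem rTensor_injective_of_extend [IsNoetherianRing R] [Module.Finite R E]
    [Module.Injective R J] (f : E →ₗ[R] F)
    (h : ∀ φ : E →ₗ[R] C, ∃ ψ : F →ₗ[R] C, ψ ∘ₗ f = φ) :
    Function.Injective (f.rTensor (C →ₗ[R] J)) := by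
  rw [← LinearMap.ker_eq_bot, LinearMap.ker_eq_bot']
  intro t ht
  apply (homEval_bijective (R := R) (C := C) (J := J)).1
  ext φ
  obtain ⟨ψ, rfl⟩ := h φ
  rw [← homEval_rTensor, ht]
  simp

end

/-! ### Proper sequences obtained by applying Hom(-, I) -/

section
variable {R : Type u} [CommRing R] [IsNoetherianRing R] {C : Type u} [AddCommGroup C] [Module R C]
  (I : Type u) [AddCommGroup I] [Module R I] [Module.Injective R I]
  {K F E : Type u} [AddCommGroup K] [Module R K] [AddCommGroup F] [Module R F]
  [AddCommGroup E] [Module R E] {f : K →ₗ[R] F} {g : F →ₗ[R] E}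

theorem properSES_lcomp [Module.Finite R K]
    (hf : Function.Injective f) (hfg : Function.Exact f g) (hg : Function.Surjective g)
    (h : ∀ φ : K →ₗ[R] C, ∃ ψ : F →ₗ[R] C, ψ ∘ₗ f = φ) :
    ProperSES (homInjectiveModules R C) (g.lcomp R I) (f.lcomp R I) := by
  refine ⟨lcomp_injective hg, lcomp_exact hfg hg, ?_, ?_⟩
  · intro φ
    exact Module.Injective.extension_property R I _ _ f hf φ
  · rintro X ⟨J, hJ, ⟨e⟩⟩ φ
    have : Module.Injective R J := hJ
    -- Lifting a map Hom(C, J) → Hom(K, I) means extending its adjoint from K ⊗ Hom(C, J) to F ⊗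
    -- Hom(C, J).
    obtain ⟨ψ, hψ⟩ := Module.Injective.extension_property R I _ _
      (f.rTensor (C →ₗ[R] J)) (rTensor_injective_of_extend f h)
      (TensorProduct.lift (φ ∘ₗ e.symm.toLinearMap).flip)
    refine ⟨(TensorProduct.curry ψ).flip ∘ₗ e.toLinearMap, ?_⟩
    ext x y
    have := congr($hψ (y ⊗ₜ e x))
    simpa using this

/-- Hom(-, I) turns a resolution of E by finite free modules into a proper injective coresolution;
the syzygies keep Ext(-, C) = 0. -/
theorem extVanish_hom_of_extVanish [Module.Finite R E] (hE : ExtVanish R E C)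
    {X : ModuleCat.{u} R} (hX : homInjectiveModules R C X) : ExtVanish R X (E →ₗ[R] I) := by
  refine extVanish_of_hasChain (ℬ := injectiveModules R) (N := ModuleCat.of R (E →ₗ[R] I))
    (fun E hE X hX => ?_) ?_ hX
  · have : Module.Injective R E := hE
    exact ExtVanish.of_injective
  · clear hX
    refine ⟨fun N => ∃ E : ModuleCat.{u} R, Module.Finite R E ∧ ExtVanish R E C ∧
      N = ModuleCat.of R (E →ₗ[R] I), ⟨ModuleCat.of R E, inferInstance, hE, rfl⟩, ?_⟩
    rintro _ ⟨E, hfin, hE, rfl⟩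
    obtain ⟨n, π, hπ⟩ := Module.Finite.exists_fin' R E
    have hex := LinearMap.exact_subtype_ker_map π
    have hinj : Module.Injective R ((Fin n → R) →ₗ[R] I) :=
      Module.Baer.injective (Module.Baer.of_equiv (LinearEquiv.piRing R I (Fin n) R).symm
        (Module.Baer.of_injective inferInstance))
    exact ⟨ModuleCat.of R (LinearMap.ker π →ₗ[R] I), ⟨ModuleCat.of R ((Fin n → R) →ₗ[R] I), _, _,
      hinj, properSES_lcomp I Subtype.val_injective hex hπ
        (hE.exists_extend Subtype.val_injective hex hπ)⟩, ModuleCat.of R (LinearMap.ker π),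
        Module.Finite.of_fg (IsNoetherian.noetherian _),
        ExtVanish.left Subtype.val_injective hex hπ ExtVanish.of_projective hE, rfl⟩

end

/-! ### Totally reflexive modules and resolutions of injectives -/

section
variable {R : Type u} [CommRing R]

theorem LeftResolved.of_mem {𝒜 : ObjectProperty (ModuleCat.{u} R)} {Z A : ModuleCat.{u} R}
    (hZ : 𝒜 Z) [Subsingleton Z] (hA : 𝒜 A) : LeftResolved 𝒜 A := by
  refine ⟨𝒜, hA, fun N hN => ⟨Z, ⟨N, 0, LinearMap.id, hN, Function.injective_of_subsingleton _,
    ?_, Function.surjective_id, fun B _ φ => ⟨φ, rfl⟩⟩, hZ⟩⟩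
  intro x
  simp [eq_comm]

instance Module.Injective.prod (I J : Type u) [AddCommGroup I] [Module R I] [AddCommGroup J]
    [Module R J] [Module.Injective R I] [Module.Injective R J] : Module.Injective R (I × J) := by
  refine ⟨fun X Y _ _ _ _ f hf g => ?_⟩
  obtain ⟨h₁, hh₁⟩ := extension_property R I _ _ f hf (LinearMap.fst R I J ∘ₗ g)
  obtain ⟨h₂, hh₂⟩ := extension_property R J _ _ f hf (LinearMap.snd R I J ∘ₗ g)
  exact ⟨h₁.prod h₂, fun x => Prod.ext congr($hh₁ x) congr($hh₂ x)⟩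

theorem Module.Injective.of_retract {I J : Type u} [AddCommGroup I] [Module R I] [AddCommGroup J]
    [Module R J] [Module.Injective R J] (s : I →ₗ[R] J) (r : J →ₗ[R] I)
    (h : r ∘ₗ s = LinearMap.id) : Module.Injective R I := by
  refine ⟨fun X Y _ _ _ _ f hf g => ?_⟩
  obtain ⟨k, hk⟩ := extension_property R J _ _ f hf (s ∘ₗ g)
  refine ⟨r ∘ₗ k, fun x => ?_⟩
  have h1 : k (f x) = s (g x) := congr($hk x)
  have h2 : r (s (g x)) = g x := congr($h (g x))
  simp [h1, h2]

theorem injectiveModules_prod (A B : ModuleCat.{u} R) (hA : injectiveModules R A)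
    (hB : injectiveModules R B) : injectiveModules R (ModuleCat.of R (A × B)) := by
  have : Module.Injective R A := hA
  have : Module.Injective R B := hB
  exact Module.Injective.prod A B

theorem leftResolved_of_injective (A : ModuleCat.{u} R) [hA : Module.Injective R A] :
    LeftResolved (injectiveModules R) A := by
  refine LeftResolved.of_mem (Z := ModuleCat.of R PUnit) ?_ hA
  exact ⟨fun X Y _ _ _ _ f hf g => ⟨0, fun x => Subsingleton.elim _ _⟩⟩

variable {C : Type u} [AddCommGroup C] [Module R C]

theorem homInjectiveModules_hom (I : Type u) [AddCommGroup I] [Module R I]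
    [hI : Module.Injective R I] : homInjectiveModules R C (ModuleCat.of R (C →ₗ[R] I)) :=
  ⟨ModuleCat.of R I, hI, ⟨LinearEquiv.refl R _⟩⟩

theorem homInjectiveModules_prod (A B : ModuleCat.{u} R) (hA : homInjectiveModules R C A)
    (hB : homInjectiveModules R C B) : homInjectiveModules R C (ModuleCat.of R (A × B)) := by
  obtain ⟨I, hI, ⟨e⟩⟩ := hA
  obtain ⟨J, hJ, ⟨e'⟩⟩ := hB
  exact ⟨ModuleCat.of R (I × J), injectiveModules_prod I J hI hJ,
    ⟨e.prodCongr e' ≪≫ₗ LinearMap.prodEquiv R⟩⟩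

theorem leftResolved_of_homInjective {A : ModuleCat.{u} R} (hA : homInjectiveModules R C A) :
    LeftResolved (homInjectiveModules R C) A := by
  have : Module.Injective R PUnit.{u + 1} :=
    ⟨fun X Y _ _ _ _ f hf g => ⟨0, fun x => Subsingleton.elim _ _⟩⟩
  have : Subsingleton (ModuleCat.of R (C →ₗ[R] PUnit.{u + 1})) :=
    inferInstanceAs (Subsingleton (C →ₗ[R] PUnit.{u + 1}))
  exact LeftResolved.of_mem (homInjectiveModules_hom (R := R) (C := C) PUnit.{u + 1}) hA

/-- Put θ = e 1. Every endomorphism is a multiple of θ, in particular r θ = id and a θ = θ². Hence θ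
is multiplication by a, and every endomorphism is a homothety. -/
theorem IsSemidualizing.lsmul_bijective (hC : IsSemidualizing R C) :
    Function.Bijective (LinearMap.lsmul R C) := by
  obtain ⟨e⟩ := hC.nonempty_equiv
  have he : ∀ r, e r = r • e 1 := fun r => by rw [← map_smul, smul_eq_mul, mul_one]
  constructor
  · rw [← LinearMap.ker_eq_bot, LinearMap.ker_eq_bot']
    intro a ha
    rw [← map_eq_zero_iff e e.injective, he]
    ext c
    exact congr($ha (e 1 c))
  · intro φ
    obtain ⟨r, hr⟩ := e.surjective LinearMap.id
    obtain ⟨a, ha⟩ := e.surjective (e 1 ∘ₗ e 1)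
    obtain ⟨s, rfl⟩ := e.surjective φ
    rw [he] at hr ha ⊢
    refine ⟨s * a, ?_⟩
    ext c
    have h1 : ∀ c, a • e 1 c = e 1 (e 1 c) := fun c => congr($ha c)
    have h2 : ∀ c, r • e 1 c = c := fun c => congr($hr c)
    simp only [LinearMap.lsmul_apply, LinearMap.smul_apply, mul_smul]
    congr 1
    rw [← h2 c, map_smul, ← h1, smul_comm]

/-- The totally `C`-reflexive modules. -/
structure IsTotallyReflexive (R : Type u) [CommRing R] (C : Type u) [AddCommGroup C] [Module R C]
    (D : Type u) [AddCommGroup D] [Module R D] : Prop where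
  finite : Module.Finite R D
  ext : ExtVanish R D C
  ext_dual : ExtVanish R (D →ₗ[R] C) C
  bidual : Function.Bijective (LinearMap.applyₗ : D →ₗ[R] (D →ₗ[R] C) →ₗ[R] C)

/-- The homothety isomorphism of a semidualizing module. -/
noncomputable def IsSemidualizing.equiv (hC : IsSemidualizing R C) : R ≃ₗ[R] (C →ₗ[R] C) :=
  LinearEquiv.ofBijective (LinearMap.lsmul R C) hC.lsmul_bijective

theorem IsSemidualizing.isTotallyReflexive (hC : IsSemidualizing R C) :
    IsTotallyReflexive R C C where
  finite := hC.finite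
  ext := hC.ext_eq_zero
  ext_dual := ExtVanish.of_projective.congr_left hC.equiv
  bidual := by
    constructor
    · intro a b hab
      exact congr($hab LinearMap.id)
    · intro φ
      refine ⟨φ LinearMap.id, ?_⟩
      ext ψ
      obtain ⟨r, rfl⟩ := hC.lsmul_bijective.2 ψ
      have : LinearMap.lsmul R C r = r • LinearMap.id := rfl
      simp only [this, map_smul]
      rfl

theorem IsSemidualizing.bidual_pi (hC : IsSemidualizing R C) (n : ℕ) : Function.Bijective
    (LinearMap.applyₗ : (Fin n → R) →ₗ[R] ((Fin n → R) →ₗ[R] C) →ₗ[R] C) := by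
  constructor
  · rw [← LinearMap.ker_eq_bot, LinearMap.ker_eq_bot']
    intro x hx
    ext j
    apply hC.lsmul_bijective.1
    ext c
    simpa using congr($hx ((LinearMap.proj j : (Fin n → R) →ₗ[R] R).smulRight c))
  · intro φ
    choose r hr using fun j => hC.lsmul_bijective.2
      (φ ∘ₗ LinearMap.smulRightₗ (LinearMap.proj j : (Fin n → R) →ₗ[R] R))
    refine ⟨r, ?_⟩
    ext ψ
    have h1 : ψ = ∑ j, (LinearMap.proj j : (Fin n → R) →ₗ[R] R).smulRight (ψ (Pi.single j 1)) := by
      ext k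
      simp [Pi.single_apply]
    rw [h1]
    simp only [LinearMap.applyₗ_apply_apply, map_sum]
    exact Finset.sum_congr rfl fun j _ => congr($(hr j) _)

theorem extVanish_prod {X Y Z : Type u} [AddCommGroup X] [Module R X] [AddCommGroup Y]
    [Module R Y] [AddCommGroup Z] [Module R Z] (hX : ExtVanish R X Z) (hY : ExtVanish R Y Z) :
    ExtVanish R (X × Y) Z :=
  ExtVanish.middle_left (f := LinearMap.inl R X Y) (g := LinearMap.snd R X Y)
    LinearMap.inl_injective Function.Exact.inl_snd LinearMap.snd_surjective hX hY

theorem extVanish_pi {X Z : Type u} [AddCommGroup X] [Module R X] [AddCommGroup Z] [Module R Z]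
    (hX : ExtVanish R X Z) (n : ℕ) : ExtVanish R (Fin n → X) Z := by
  induction n with
  | zero =>
    have : Module.Projective R (Fin 0 → X) := Module.Projective.of_equiv
      (LinearEquiv.ofSubsingleton (R := R) (Fin 0 → R) (Fin 0 → X))
    exact ExtVanish.of_projective
  | succ n ih => exact (extVanish_prod hX ih).congr_left (Fin.consLinearEquiv R fun _ => X)

theorem IsTotallyReflexive.exists_extend_lcomp {D F : Type u} [AddCommGroup D] [Module R D]
    [AddCommGroup F] [Module R F] {π : F →ₗ[R] D} (hπ : Function.Surjective π)
    (hD : IsTotallyReflexive R C D) (φ : (D →ₗ[R] C) →ₗ[R] C) :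
    ∃ ψ : (F →ₗ[R] C) →ₗ[R] C, ψ ∘ₗ π.lcomp R C = φ := by
  obtain ⟨d, rfl⟩ := hD.bidual.2 φ
  obtain ⟨x, rfl⟩ := hπ d
  exact ⟨LinearMap.applyₗ x, rfl⟩

theorem IsTotallyReflexive.syzygy [IsNoetherianRing R] (hC : IsSemidualizing R C) {D : Type u}
    [AddCommGroup D] [Module R D] (hD : IsTotallyReflexive R C D) {n : ℕ}
    {π : (Fin n → R) →ₗ[R] D} (hπ : Function.Surjective π) :
    IsTotallyReflexive R C (LinearMap.ker π) := by
  have hex := LinearMap.exact_subtype_ker_map π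
  have hext := hD.ext.exists_extend Subtype.val_injective hex hπ
  have hres : Function.Surjective ((LinearMap.ker π).subtype.lcomp R C) := hext
  refine ⟨Module.Finite.of_fg (IsNoetherian.noetherian _),
    ExtVanish.left Subtype.val_injective hex hπ ExtVanish.of_projective hD.ext, ?_, ?_, ?_⟩
  · exact ExtVanish.right (lcomp_injective hπ) (lcomp_exact hex hπ) hres hD.ext_dual
      ((extVanish_pi hC.ext_eq_zero n).congr_left (LinearEquiv.piRing R C (Fin n) R).symm)
      (hD.exists_extend_lcomp hπ)
  · rw [← LinearMap.ker_eq_bot, LinearMap.ker_eq_bot']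
    intro x hx
    apply Subtype.ext
    apply (hC.bidual_pi n).1
    ext ψ
    simpa using congr($hx (ψ ∘ₗ (LinearMap.ker π).subtype))
  · intro φ
    obtain ⟨x, hx⟩ := (hC.bidual_pi n).2 (φ ∘ₗ (LinearMap.ker π).subtype.lcomp R C)
    have hx' : ∀ ψ : (Fin n → R) →ₗ[R] C, ψ x = φ (ψ ∘ₗ (LinearMap.ker π).subtype) :=
      fun ψ => congr($hx ψ)
    -- Maps factoring through `π` restrict to zero on ker π, so all functionals D → C kill π x; D is
    -- reflexive.
    have hπx : π x = 0 := by
      apply hD.bidual.1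
      ext ψ
      have h0 : (ψ ∘ₗ π) ∘ₗ (LinearMap.ker π).subtype = 0 := by
        ext y
        have : π y = 0 := y.2
        simp [this]
      have := hx' (ψ ∘ₗ π)
      rw [h0] at this
      simpa using this
    refine ⟨⟨x, hπx⟩, ?_⟩
    ext ψ
    obtain ⟨χ, rfl⟩ := hext ψ
    exact hx' χ

/-- Apply Hom(Hom(-, C), I) to 0 → ker π → Rⁿ → D → 0. The middle term is Hom(Cⁿ, I) ≅ Hom(C, Iⁿ),
and ker π is again totally reflexive. -/
theorem IsTotallyReflexive.leftResolved [IsNoetherianRing R] (hC : IsSemidualizing R C)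
    {D : Type u} [AddCommGroup D] [Module R D] (hD : IsTotallyReflexive R C D)
    (I : Type u) [AddCommGroup I] [Module R I] [Module.Injective R I] :
    LeftResolved (homInjectiveModules R C) (ModuleCat.of R ((D →ₗ[R] C) →ₗ[R] I)) := by
  have := hC.finite
  refine ⟨fun K => ∃ D : ModuleCat.{u} R, IsTotallyReflexive R C D ∧
    K = ModuleCat.of R ((D →ₗ[R] C) →ₗ[R] I), ⟨ModuleCat.of R D, hD, rfl⟩, ?_⟩
  rintro _ ⟨D, hD, rfl⟩
  have := hD.finite
  obtain ⟨n, π, hπ⟩ := Module.Finite.exists_fin' R D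
  have hex := LinearMap.exact_subtype_ker_map π
  have hext := hD.ext.exists_extend Subtype.val_injective hex hπ
  have hD' := hD.syzygy hC hπ
  refine ⟨_, ⟨ModuleCat.of R (((Fin n → R) →ₗ[R] C) →ₗ[R] I), _, _, ?_,
    properSES_lcomp (C := C) I (lcomp_injective hπ) (lcomp_exact hex hπ) hext
      (hD.exists_extend_lcomp hπ)⟩, ModuleCat.of R (LinearMap.ker π), hD', rfl⟩
  exact ⟨ModuleCat.of R (Fin n → I), Module.Injective.pi R fun _ => I,
    ⟨(LinearEquiv.piRing R C (Fin n) R).congrLeft I R ≪≫ₗ (LinearMap.lsum R (fun _ => C) R).symm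
      ≪≫ₗ LinearEquiv.linearMapPi R⟩⟩

/-- The case D = C, where Hom(Hom(C, C), I) ≅ I. -/
theorem IsSemidualizing.leftResolved_injective [IsNoetherianRing R] (hC : IsSemidualizing R C)
    (I : Type u) [AddCommGroup I] [Module R I] [Module.Injective R I] :
    LeftResolved (homInjectiveModules R C) (ModuleCat.of R I) :=
  (hC.isTotallyReflexive.leftResolved hC I).of_equiv
    (hC.equiv.symm.congrLeft I R ≪≫ₗ LinearMap.ringLmapEquivSelf R R I)

open TensorProduct in
theorem IsSemidualizing.leftResolved_tensor [IsNoetherianRing R] (hC : IsSemidualizing R C)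
    (J : Type u) [AddCommGroup J] [Module R J] [Module.Injective R J] :
    LeftResolved (homInjectiveModules R C) (ModuleCat.of R (C ⊗[R] (C →ₗ[R] J))) := by
  have := hC.finite
  exact (hC.leftResolved_injective J).of_equiv
    ((LinearEquiv.ofBijective _ (homEval_bijective (R := R) (C := C) (J := J) (E := C)) ≪≫ₗ
      hC.equiv.symm.congrLeft J R ≪≫ₗ LinearMap.ringLmapEquivSelf R R J).symm)

end

/-! ### Coinduced modules and the S-modules S ⊗ Hom(C, J) -/

section
open TensorProduct
variable {R : Type u} [CommRing R] {S : Type u} [CommRing S] [Algebra R S]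

section coinduced
variable {U J : Type u} [AddCommGroup U] [Module R U] [Module S U] [IsScalarTower R S U]
  [AddCommGroup J] [Module R J]

/-- The map `u ↦ (s ↦ l (s • u))` from `U` to `Hom_R(S, J)` is bijective. -/
def IsCoinduced (S : Type u) [CommRing S] [Algebra R S] [Module S U] (l : U →ₗ[R] J) : Prop :=
  ∀ μ : S →ₗ[R] J, ∃! u : U, ∀ s : S, l (s • u) = μ s

variable {l : U →ₗ[R] J} (hl : IsCoinduced S l)
  {N : Type u} [AddCommGroup N] [Module R N] [Module S N] [IsScalarTower R S N]
include hl

theorem IsCoinduced.eq_of_forall {u v : U} (h : ∀ s : S, l (s • u) = l (s • v)) : u = v :=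
  (hl (l ∘ₗ (LinearMap.toSpanSingleton S U v).restrictScalars R)).unique h fun _ => rfl

theorem IsCoinduced.exists_lift (ν : N →ₗ[R] J) : ∃ φ : N →ₗ[S] U, ∀ n, l (φ n) = ν n := by
  choose φ hφ hφ' using fun n : N =>
    hl (ν ∘ₗ (LinearMap.toSpanSingleton S N n).restrictScalars R)
  have hφ : ∀ n (s : S), l (s • φ n) = ν (s • n) := hφ
  refine ⟨{ toFun := φ, map_add' := fun a b => hl.eq_of_forall fun s => ?_,
            map_smul' := fun t a => hl.eq_of_forall fun s => ?_ }, fun n => ?_⟩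
  · simp only [hφ, smul_add, map_add]
  · simp only [hφ, ← mul_smul, RingHom.id_apply]
  · simpa using hφ n 1

/-- Coinduction is right adjoint to restriction of scalars, which is exact. -/
theorem IsCoinduced.injective [Module.Injective R J] : Module.Injective S U := by
  refine ⟨fun X Y _ _ _ _ f hf k => ?_⟩
  let _ : Module R X := Module.compHom X (algebraMap R S)
  let _ : Module R Y := Module.compHom Y (algebraMap R S)
  have : IsScalarTower R S X := IsScalarTower.of_algebraMap_smul fun _ _ => rfl
  have : IsScalarTower R S Y := IsScalarTower.of_algebraMap_smul fun _ _ => rfl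
  obtain ⟨ν, hν⟩ := Module.Injective.extension_property R J _ _ (f.restrictScalars R) hf
    (l ∘ₗ k.restrictScalars R)
  have hν : ∀ x, ν (f x) = l (k x) := fun x => congr($hν x)
  obtain ⟨φ, hφ⟩ := hl.exists_lift ν
  refine ⟨φ, fun x => hl.eq_of_forall fun s => ?_⟩
  rw [← map_smul φ, ← map_smul f, hφ, hν, map_smul k]

theorem IsCoinduced.exists_injective {j : N →ₗ[R] J} (hj : Function.Injective j) :
    ∃ φ : N →ₗ[S] U, Function.Injective φ := by
  obtain ⟨φ, hφ⟩ := hl.exists_lift j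
  refine ⟨φ, fun a b hab => hj ?_⟩
  rw [← hφ, ← hφ, hab]

end coinduced

variable {C : Type u} [AddCommGroup C] [Module R C] {g : S →ₐ[R] R}

theorem homEval_smul {J : Type u} [AddCommGroup J] [Module R J] (s : S) (u : S ⊗[R] (C →ₗ[R] J))
    (φ : S →ₗ[R] C) :
    homEval R C J S (s • u) φ = homEval R C J S u (φ ∘ₗ LinearMap.mulLeft R s) := by
  induction u using TensorProduct.induction_on with
  | zero => simp
  | tmul t x => simp [TensorProduct.smul_tmul']
  | add a b ha hb => simp only [smul_add, map_add, LinearMap.add_apply, ha, hb]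

theorem IsDualizingRetract.exists_linearEquiv (h : IsDualizingRetract R S g C) :
    ∃ e : (S →ₗ[R] C) ≃ₗ[R] S,
      ∀ (s : S) (φ : S →ₗ[R] C), e (φ ∘ₗ LinearMap.mulLeft R s) = s * e φ := by
  obtain ⟨e, he⟩ := h.hom_equiv
  refine ⟨{ e with map_smul' := fun r φ => ?_ }, he⟩
  have h1 : r • φ = φ ∘ₗ LinearMap.mulLeft R (algebraMap R S r) := by
    ext s
    simp [← Algebra.smul_def]
  change e (r • φ) = r • e φ
  rw [h1, he, Algebra.smul_def]

/-- This is the R-linear splitting S = R ⊕ ker g ≅ R ⊕ C. -/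
theorem IsDualizingRetract.exists_section (h : IsDualizingRetract R S g C) :
    ∃ (ι : C →ₗ[R] S) (κ : S →ₗ[R] C), κ ∘ₗ ι = LinearMap.id ∧ κ 1 = 0 ∧
      ∀ s, ι (κ s) = s - algebraMap R S (g s) := by
  obtain ⟨e⟩ := h.ker_equiv
  have hmem : ∀ s, s - algebraMap R S (g s) ∈ RingHom.ker g := fun s => by
    simp [RingHom.mem_ker]
  let κ' : S →ₗ[R] RingHom.ker g :=
    { toFun := fun s => ⟨s - algebraMap R S (g s), hmem s⟩
      map_add' := fun a b => Subtype.ext (by simp only [map_add]; exact add_sub_add_comm _ _ _ _)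
      map_smul' := fun r a => Subtype.ext (by
        change r • a - algebraMap R S (g (r • a)) = r • (a - algebraMap R S (g a))
        rw [map_smul, smul_eq_mul, map_mul, ← Algebra.smul_def, smul_sub]) }
  refine ⟨{ toFun := fun c => (e c : S), map_add' := by simp, map_smul' := by simp },
    e.symm.toLinearMap ∘ₗ κ', ?_, ?_, ?_⟩
  · ext c
    have hc : g (e c) = 0 := (e c).2
    have : κ' (e c) = e c := Subtype.ext (by
      change (e c : S) - algebraMap R S (g (e c)) = e c
      rw [hc, map_zero, sub_zero])
    simp [this]
  · have : κ' 1 = 0 := Subtype.ext (by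
      change (1 : S) - algebraMap R S (g 1) = 0
      simp)
    simp [this]
  · intro s
    simp [κ']

theorem IsDualizingRetract.finite (hC : IsSemidualizing R C) (h : IsDualizingRetract R S g C) :
    Module.Finite R S := by
  have := hC.finite
  obtain ⟨ι, κ, -, -, hικ⟩ := h.exists_section
  refine Module.Finite.of_surjective ((Algebra.linearMap R S).coprod ι) fun s => ⟨(g s, κ s), ?_⟩
  simp [hικ]

section
variable [IsNoetherianRing R] (hC : IsSemidualizing R C) (h : IsDualizingRetract R S g C)
  (J : Type u) [AddCommGroup J] [Module R J] [Module.Injective R J]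
include hC h

theorem IsDualizingRetract.exists_isCoinduced :
    ∃ l : S ⊗[R] (C →ₗ[R] J) →ₗ[R] J, IsCoinduced S l := by
  have := h.finite hC
  obtain ⟨e, he⟩ := h.exists_linearEquiv
  have h1 : ∀ s, e.symm 1 ∘ₗ LinearMap.mulLeft R s = e.symm s := fun s => by
    rw [LinearEquiv.eq_symm_apply, he, e.apply_symm_apply, mul_one]
  -- Under S ⊗ Hom(C, J) ≅ Hom(Hom(S, C), J) ≅ Hom(S, J), this functional is evaluation at 1.
  refine ⟨LinearMap.applyₗ (e.symm 1) ∘ₗ homEval R C J S, fun μ => ?_⟩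
  obtain ⟨u, hu⟩ := (homEval_bijective (R := R) (E := S)).2 (μ ∘ₗ e.toLinearMap)
  have hs : ∀ u (s : S), (LinearMap.applyₗ (e.symm 1) ∘ₗ homEval R C J S) (s • u) =
      homEval R C J S u (e.symm s) := fun u s => by
    rw [← h1 s, ← homEval_smul]
    rfl
  refine ⟨u, fun s => ?_, fun v hv => ?_⟩
  · rw [hs, hu]
    simp
  · apply (homEval_bijective (R := R) (E := S)).1
    rw [hu]
    ext φ
    have := hv (e φ)
    rwa [hs, e.symm_apply_apply] at this

theorem IsDualizingRetract.injective_tensor : Module.Injective S (S ⊗[R] (C →ₗ[R] J)) :=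
  (h.exists_isCoinduced hC J).choose_spec.injective

theorem IsDualizingRetract.extVanish_tensor {X : ModuleCat.{u} R}
    (hX : homInjectiveModules R C X) : ExtVanish R X (S ⊗[R] (C →ₗ[R] J)) := by
  have := h.finite hC
  obtain ⟨e, he⟩ := h.exists_linearEquiv
  exact (extVanish_hom_of_extVanish J (E := S) h.ext_eq_zero hX).congr_right
    ((LinearEquiv.ofBijective _ (homEval_bijective (R := R) (C := C) (J := J) (E := S)) ≪≫ₗ
      e.congrLeft J R).symm)

/-- An R-embedding of W in an injective J induces an S-embedding in the coinduced module, which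
splits because W is S-injective. -/
theorem IsDualizingRetract.exists_retract (W : Type u) [AddCommGroup W] [Module S W]
    [Module.Injective S W] :
    ∃ J : ModuleCat.{u} R, Module.Injective R J ∧
      ∃ (s : W →ₗ[S] S ⊗[R] (C →ₗ[R] J)) (r : S ⊗[R] (C →ₗ[R] J) →ₗ[S] W),
        r ∘ₗ s = LinearMap.id := by
  let _ : Module R W := Module.compHom W (algebraMap R S)
  have : IsScalarTower R S W := IsScalarTower.of_algebraMap_smul fun _ _ => rfl
  obtain ⟨J, j, hJ, hj⟩ := exists_injective_embedding (R := R) W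
  obtain ⟨l, hl⟩ := h.exists_isCoinduced hC J
  obtain ⟨s, hs⟩ := hl.exists_injective hj
  obtain ⟨r, hr⟩ := Module.Injective.extension_property S W _ _ s hs LinearMap.id
  exact ⟨J, hJ, s, r, hr⟩

end

theorem IsDualizingRetract.exists_split (h : IsDualizingRetract R S g C) (X : Type u)
    [AddCommGroup X] [Module R X] :
    ∃ (κ : S ⊗[R] X →ₗ[R] C ⊗[R] X) (ι : C ⊗[R] X →ₗ[R] S ⊗[R] X),
      κ ∘ₗ ι = LinearMap.id ∧ Function.Injective (TensorProduct.mk R S X 1) ∧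
        Function.Exact (TensorProduct.mk R S X 1) κ := by
  obtain ⟨ι, κ, hκι, hκ, hικ⟩ := h.exists_section
  let ρ : S ⊗[R] X →ₗ[R] X := TensorProduct.lid R X ∘ₗ g.toLinearMap.rTensor X
  have hρ : ∀ u, ι.rTensor X (κ.rTensor X u) = u - 1 ⊗ₜ ρ u := by
    intro u
    induction u using TensorProduct.induction_on with
    | zero => simp
    | tmul s x =>
      simp [ρ, hικ, TensorProduct.sub_tmul, Algebra.algebraMap_eq_smul_one, TensorProduct.smul_tmul]
    | add a b ha hb =>
      simp only [map_add, ha, hb, TensorProduct.tmul_add]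
      abel
  refine ⟨κ.rTensor X, ι.rTensor X, ?_, ?_, fun u => ⟨fun hu => ⟨ρ u, ?_⟩, ?_⟩⟩
  · rw [← LinearMap.rTensor_comp, hκι, LinearMap.rTensor_id]
  · intro x y hxy
    simpa [ρ] using congr(ρ $hxy)
  · have := hρ u
    rw [hu, map_zero] at this
    exact (sub_eq_zero.1 this.symm).symm
  · rintro ⟨x, rfl⟩
    simp [hκ]

section
variable [IsNoetherianRing R] (hC : IsSemidualizing R C) (h : IsDualizingRetract R S g C)
  (J : Type u) [AddCommGroup J] [Module R J] [Module.Injective R J]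
include hC h

theorem IsDualizingRetract.leftResolved_tensor_self : LeftResolved (homInjectiveModules R C)
    (ModuleCat.of R (S ⊗[R] (C →ₗ[R] J))) := by
  obtain ⟨κ, ι, hκι, hinj, hex⟩ := h.exists_split (C →ₗ[R] J)
  exact LeftResolved.of_properSES homInjectiveModules_prod
    (P := ModuleCat.of R (C →ₗ[R] J)) (L := ModuleCat.of R (S ⊗[R] (C →ₗ[R] J)))
    (K := ModuleCat.of R (C ⊗[R] (C →ₗ[R] J))) (ProperSES.of_split hinj hex hκι)
    (leftResolved_of_homInjective (homInjectiveModules_hom J)) (hC.leftResolved_tensor J)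

/-- Writing X = Hom(C, J), the kernel is a proper extension of C ⊗ X ≅ J by ker p. A map into C ⊗ X
goes to S ⊗ X by `ι`; its value in N is then cancelled by a term 1 ⊗ ψ, with ψ a lift through p. -/
theorem IsDualizingRetract.leftResolved_ker {N : Type u} [AddCommGroup N] [Module R N] [Module S N]
    [IsScalarTower R S N] {p : (C →ₗ[R] J) →ₗ[R] N}
    (hp : ProperSES (homInjectiveModules R C) (LinearMap.ker p).subtype p)
    (hker : LeftResolved (homInjectiveModules R C) (ModuleCat.of R (LinearMap.ker p))) :
    LeftResolved (homInjectiveModules R C)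
      (ModuleCat.of R (LinearMap.ker (p.liftBaseChange S))) := by
  obtain ⟨κ, ι, hκι, hinj, hex⟩ := h.exists_split (C →ₗ[R] J)
  have hone : ∀ x, p.liftBaseChange S (1 ⊗ₜ x) = p x := fun x => by simp
  have hκone : ∀ x, κ (1 ⊗ₜ x) = 0 := hex.apply_apply_eq_zero
  let P : S ⊗[R] (C →ₗ[R] J) →ₗ[R] N := (p.liftBaseChange S).restrictScalars R
  let a : LinearMap.ker p →ₗ[R] LinearMap.ker (p.liftBaseChange S) :=
    { toFun := fun x => ⟨1 ⊗ₜ x.1, (hone x).trans x.2⟩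
      map_add' := fun x y => Subtype.ext (TensorProduct.tmul_add _ _ _)
      map_smul' := fun r x => Subtype.ext (TensorProduct.tmul_smul _ _ _) }
  let incl : LinearMap.ker (p.liftBaseChange S) →ₗ[R] S ⊗[R] (C →ₗ[R] J) :=
    (LinearMap.ker (p.liftBaseChange S)).subtype.restrictScalars R
  have hlift : ∀ (X : Type u) [AddCommGroup X] [Module R X] (φ : X →ₗ[R] C ⊗[R] (C →ₗ[R] J))
      (ψ : X →ₗ[R] (C →ₗ[R] J)), p ∘ₗ ψ = P ∘ₗ ι ∘ₗ φ →
      ∃ χ : X →ₗ[R] LinearMap.ker (p.liftBaseChange S), (κ ∘ₗ incl) ∘ₗ χ = φ := by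
    intro X _ _ φ ψ hψ
    have hmem : ∀ x, ι (φ x) - 1 ⊗ₜ ψ x ∈ LinearMap.ker (p.liftBaseChange S) := by
      intro x
      have h1 : p (ψ x) = p.liftBaseChange S (ι (φ x)) := congr($hψ x)
      rw [LinearMap.mem_ker, map_sub, hone, h1, sub_self]
    refine ⟨{ toFun := fun x => ⟨_, hmem x⟩
              map_add' := fun x y => Subtype.ext ?_
              map_smul' := fun r x => Subtype.ext ?_ }, ?_⟩
    · simp only [map_add, TensorProduct.tmul_add]
      exact add_sub_add_comm _ _ _ _
    · simp only [map_smul, TensorProduct.tmul_smul]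
      exact (smul_sub _ _ _).symm
    · ext x
      change κ (ι (φ x) - 1 ⊗ₜ ψ x) = φ x
      rw [map_sub, hκone, sub_zero]
      exact congr($hκι (φ x))
  refine LeftResolved.of_properSES homInjectiveModules_prod
    (P := ModuleCat.of R (LinearMap.ker p)) (K := ModuleCat.of R (C ⊗[R] (C →ₗ[R] J)))
    (i := a) (p := κ ∘ₗ incl) ⟨?_, ?_, ?_, ?_⟩ hker (hC.leftResolved_tensor J)
  · intro x y hxy
    exact Subtype.ext (hinj (congr_arg Subtype.val hxy))
  · rintro ⟨u, hu⟩
    constructor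
    · intro hu'
      obtain ⟨x, rfl⟩ := (hex u).1 hu'
      exact ⟨⟨x, (hone x).symm.trans hu⟩, rfl⟩
    · rintro ⟨x, hx⟩
      obtain rfl : 1 ⊗ₜ x.1 = u := congr_arg Subtype.val hx
      exact hκone _
  · intro b
    obtain ⟨x, hx⟩ := hp.surj (P (ι b))
    -- Surjectivity is the same lifting with R as test module, one element at a time.
    obtain ⟨χ, hχ⟩ := hlift (ULift.{u} R)
      ((LinearMap.toSpanSingleton R _ b) ∘ₗ ULift.moduleEquiv.toLinearMap)
      ((LinearMap.toSpanSingleton R _ x) ∘ₗ ULift.moduleEquiv.toLinearMap) (by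
        ext r
        simp [hx])
    refine ⟨χ ⟨1⟩, ?_⟩
    have := congr($hχ ⟨1⟩)
    simpa using this
  · intro X hX φ
    obtain ⟨ψ, hψ⟩ := hp.lift X hX (P ∘ₗ ι ∘ₗ φ)
    exact hlift X φ ψ hψ

end
end

/-! ### Comparing resolutions over R and over S -/

section
open TensorProduct
variable {R : Type u} [CommRing R] {S : Type u} [CommRing S] [Algebra R S]
  {C : Type u} [AddCommGroup C] [Module R C] {g : S →ₐ[R] R}
  [IsNoetherianRing R] (hC : IsSemidualizing R C) (h : IsDualizingRetract R S g C)
include hC h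

theorem IsDualizingRetract.exists_lift_of_injective {E N : Type u} [AddCommGroup E] [Module R E]
    [Module S E] [IsScalarTower R S E] [AddCommGroup N] [Module R N] [Module S N]
    [IsScalarTower R S N] {p : E →ₗ[S] N}
    (hp : ∀ B : ModuleCat.{u} R, homInjectiveModules R C B → ∀ φ : B →ₗ[R] N,
      ∃ ψ : B →ₗ[R] E, p.restrictScalars R ∘ₗ ψ = φ)
    (W : ModuleCat.{u} S) (hW : injectiveModules S W) (φ : W →ₗ[S] N) :
    ∃ ψ : W →ₗ[S] E, p ∘ₗ ψ = φ := by
  have : Module.Injective S W := hW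
  obtain ⟨J, hJ, s, r, hrs⟩ := h.exists_retract hC W
  obtain ⟨ψ, hψ⟩ := hp (ModuleCat.of R (C →ₗ[R] J)) (homInjectiveModules_hom J)
    ((φ ∘ₗ r).restrictScalars R ∘ₗ TensorProduct.mk R S _ 1)
  have h1 : p ∘ₗ ψ.liftBaseChange S = φ ∘ₗ r := by
    ext x
    simpa using congr($hψ x)
  refine ⟨ψ.liftBaseChange S ∘ₗ s, ?_⟩
  rw [← LinearMap.comp_assoc, h1, LinearMap.comp_assoc, hrs, LinearMap.comp_id]

theorem IsDualizingRetract.exists_lift_of_homInjective {E N : Type u} [AddCommGroup E] [Module R E]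
    [Module S E] [IsScalarTower R S E] [AddCommGroup N] [Module R N] [Module S N]
    [IsScalarTower R S N] {p : E →ₗ[S] N}
    (hp : ∀ W : ModuleCat.{u} S, injectiveModules S W → ∀ φ : W →ₗ[S] N,
      ∃ ψ : W →ₗ[S] E, p ∘ₗ ψ = φ)
    (B : ModuleCat.{u} R) (hB : homInjectiveModules R C B) (φ : B →ₗ[R] N) :
    ∃ ψ : B →ₗ[R] E, p.restrictScalars R ∘ₗ ψ = φ := by
  obtain ⟨J, hJ, ⟨e⟩⟩ := hB
  have : Module.Injective R J := hJ
  obtain ⟨ψ, hψ⟩ := hp (ModuleCat.of S (S ⊗[R] (C →ₗ[R] J))) (h.injective_tensor hC J)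
    ((φ ∘ₗ e.symm.toLinearMap).liftBaseChange S)
  refine ⟨ψ.restrictScalars R ∘ₗ TensorProduct.mk R S _ 1 ∘ₗ e.toLinearMap, ?_⟩
  ext x
  simpa using congr($hψ (1 ⊗ₜ e x))

theorem IsDualizingRetract.properSES_restrictScalars {K E N : Type u} [AddCommGroup K]
    [Module R K] [Module S K] [IsScalarTower R S K] [AddCommGroup E] [Module R E]
    [Module S E] [IsScalarTower R S E] [AddCommGroup N] [Module R N] [Module S N]
    [IsScalarTower R S N] {i : K →ₗ[S] E} {p : E →ₗ[S] N}
    (hp : ProperSES (injectiveModules S) i p) :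
    ProperSES (homInjectiveModules R C) (i.restrictScalars R) (p.restrictScalars R) :=
  ⟨hp.inj, hp.exact, hp.surj, h.exists_lift_of_homInjective hC hp.lift⟩

theorem IsDualizingRetract.extVanish_of_injective {X : ModuleCat.{u} R}
    (hX : homInjectiveModules R C X) (W : Type u) [AddCommGroup W] [Module R W] [Module S W]
    [IsScalarTower R S W] [Module.Injective S W] : ExtVanish R X W := by
  obtain ⟨J, hJ, s, r, hrs⟩ := h.exists_retract hC W
  exact (h.extVanish_tensor hC J hX).retract_right (s.restrictScalars R) (r.restrictScalars R)
    (by ext x; exact congr($hrs x))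

/-- Over R the condition is Ext vanishing. It holds for S-injectives, so it passes along an
S-coresolution. Conversely it makes embeddings into S-injectives proper and descends to their
cokernels. -/
theorem IsDualizingRetract.rightResolved_iff (N : ModuleCat.{u} S) [Module R N]
    [IsScalarTower R S N] : RightResolved (injectiveModules S) N ↔
      RightResolved (homInjectiveModules R C) (ModuleCat.of R N) := by
  rw [rightResolved_iff_extVanish (𝒜 := homInjectiveModules R C)]
  constructor
  · rintro ⟨Q, hN, hQ⟩ X hX
    refine extVanish_of_hasChain (N := ModuleCat.of R N)
      (ℬ := fun E => ∃ (W : ModuleCat.{u} S) (_ : Module R W) (_ : IsScalarTower R S W),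
        Module.Injective S W ∧ E = ModuleCat.of R W)
      ?_ ?_ hX
    · rintro _ ⟨W, _, _, _, rfl⟩ X hX
      exact h.extVanish_of_injective hC hX W
    · refine ⟨fun N' => ∃ (N : ModuleCat.{u} S) (_ : Module R N) (_ : IsScalarTower R S N),
        Q N ∧ N' = ModuleCat.of R N, ⟨N, _, inferInstance, hN, rfl⟩, ?_⟩
      rintro _ ⟨N, _, _, hN, rfl⟩
      obtain ⟨N', ⟨E, i, p, hE, hp⟩, hN'⟩ := hQ N hN
      let _ : Module R N' := Module.compHom N' (algebraMap R S)
      let _ : Module R E := Module.compHom E (algebraMap R S)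
      have : IsScalarTower R S N' := IsScalarTower.of_algebraMap_smul fun _ _ => rfl
      have : IsScalarTower R S E := IsScalarTower.of_algebraMap_smul fun _ _ => rfl
      exact ⟨ModuleCat.of R N', ⟨ModuleCat.of R E, _, _, ⟨E, _, inferInstance, hE, rfl⟩,
        h.properSES_restrictScalars hC hp⟩, N', _, inferInstance, hN', rfl⟩
  · intro hN
    refine ⟨fun N => ∃ (_ : Module R N) (_ : IsScalarTower R S N),
      ∀ X, homInjectiveModules R C X → ExtVanish R X N, ⟨_, inferInstance, hN⟩, ?_⟩
    rintro N ⟨_, _, hN⟩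
    obtain ⟨E, j, hE, hj⟩ := exists_injective_embedding (R := S) N
    let _ : Module R E := Module.compHom E (algebraMap R S)
    have : IsScalarTower R S E := IsScalarTower.of_algebraMap_smul fun _ _ => rfl
    have hex : Function.Exact j (LinearMap.range j).mkQ := LinearMap.exact_map_mkQ_range j
    have hsurj := Submodule.mkQ_surjective (LinearMap.range j)
    refine ⟨ModuleCat.of S (E ⧸ LinearMap.range j), ⟨E, j, (LinearMap.range j).mkQ, hE, hj, hex,
      hsurj, h.exists_lift_of_injective hC fun B hB φ => ?_⟩,
      inferInstanceAs (Module R (E ⧸ LinearMap.range j)),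
      inferInstanceAs (IsScalarTower R S (E ⧸ LinearMap.range j)), fun X hX => ?_⟩
    · exact exists_lift_of_subsingleton_ext (f := j.restrictScalars R)
        (g := (LinearMap.range j).mkQ.restrictScalars R) hj hex hsurj (hN B hB 1 le_rfl) φ
    · exact (hN X hX).cosyzygy (f := j.restrictScalars R)
        (g := (LinearMap.range j).mkQ.restrictScalars R) hj hex hsurj
        (h.extVanish_of_injective hC hX E)

/-- The first term W is replaced by some S ⊗ Hom(C, J) having W as a retract. The kernel grows only
by the complement ker r, which is injective. -/
theorem IsDualizingRetract.exists_properSES_tensor {N : ModuleCat.{u} S}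
    (hN : LeftResolved (injectiveModules S) N) :
    ∃ J : ModuleCat.{u} R, Module.Injective R J ∧ ∃ p : S ⊗[R] (C →ₗ[R] J) →ₗ[S] N,
      ProperSES (injectiveModules S) (N' := LinearMap.ker p) (LinearMap.ker p).subtype p ∧
        LeftResolved (injectiveModules S) (ModuleCat.of S (LinearMap.ker p)) := by
  obtain ⟨W, q, hW, hq, hK⟩ := hN.exists_properSES
  have : Module.Injective S W := hW
  obtain ⟨J, hJ, s, r, hrs⟩ := h.exists_retract hC W
  have := h.injective_tensor hC J
  have hrs' : ∀ x, r (s x) = x := fun x => congr($hrs x)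
  have hr : ProperSES (injectiveModules S) (N' := LinearMap.ker r)
      (LinearMap.ker r).subtype r :=
    ProperSES.of_ker (fun x => ⟨s x, hrs' x⟩) fun B _ φ => ⟨s ∘ₗ φ, by
      rw [← LinearMap.comp_assoc, hrs, LinearMap.id_comp]⟩
  have hker : Module.Injective S (LinearMap.ker r) :=
    Module.Injective.of_retract (LinearMap.ker r).subtype
      ((LinearMap.id - s ∘ₗ r).codRestrict _ fun x => by simp [hrs']) (by
        ext x
        have : r x = 0 := x.2
        simp [this])
  obtain ⟨h1, i', p', h2⟩ := hq.comp hr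
  exact ⟨J, hJ, q ∘ₗ r, h1, LeftResolved.of_properSES injectiveModules_prod
    (P := ModuleCat.of S (LinearMap.ker r)) (K := ModuleCat.of S (LinearMap.ker q)) h2
    (leftResolved_of_injective _ (hA := hker)) hK⟩

theorem IsDualizingRetract.leftResolved_iff (N : ModuleCat.{u} S) [Module R N]
    [IsScalarTower R S N] : LeftResolved (injectiveModules S) N ↔
      LeftResolved (homInjectiveModules R C) (ModuleCat.of R N) := by
  constructor
  · intro hN
    -- The terms S ⊗ Hom(C, J) need not be of the form Hom(C, I) over R, but they are resolved by
    -- such modules.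
    refine LeftResolved.of_chain homInjectiveModules_prod
      ⟨fun N' => ∃ (N : ModuleCat.{u} S) (_ : Module R N) (_ : IsScalarTower R S N),
        LeftResolved (injectiveModules S) N ∧ N' = ModuleCat.of R N,
        ⟨N, _, inferInstance, hN, rfl⟩, ?_⟩
    rintro _ ⟨N, _, _, hN, rfl⟩
    obtain ⟨J, hJ, p, hp, hK⟩ := h.exists_properSES_tensor hC hN
    exact ⟨ModuleCat.of R (LinearMap.ker p), ⟨ModuleCat.of R (S ⊗[R] (C →ₗ[R] J)), _, _,
      h.leftResolved_tensor_self hC J, h.properSES_restrictScalars hC hp⟩,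
      ModuleCat.of S (LinearMap.ker p), inferInstanceAs (Module R (LinearMap.ker p)),
      inferInstanceAs (IsScalarTower R S (LinearMap.ker p)), hK, rfl⟩
  · intro hN
    refine ⟨fun N => ∃ (_ : Module R N) (_ : IsScalarTower R S N),
      LeftResolved (homInjectiveModules R C) (ModuleCat.of R N), ⟨_, inferInstance, hN⟩, ?_⟩
    rintro N ⟨_, _, hN⟩
    obtain ⟨A, p, ⟨J, hJ, ⟨e⟩⟩, hp, hK⟩ := hN.exists_properSES
    have : Module.Injective R J := hJ
    let q : (C →ₗ[R] J) →ₗ[R] N := p ∘ₗ e.symm.toLinearMap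
    have hq : ProperSES (homInjectiveModules R C) (LinearMap.ker q).subtype q := by
      refine ProperSES.of_ker (hp.surj.comp e.symm.surjective) fun B hB φ => ?_
      obtain ⟨ψ, hψ⟩ := hp.lift B hB φ
      refine ⟨e.toLinearMap ∘ₗ ψ, ?_⟩
      rw [← hψ]
      ext x
      simp [q]
    have hqK : LeftResolved (homInjectiveModules R C) (ModuleCat.of R (LinearMap.ker q)) :=
      hK.of_equiv ((e.ofSubmodules (LinearMap.ker p) (LinearMap.ker q) (by
        rw [Submodule.map_equiv_eq_comap_symm]
        rfl)))
    have hone : ∀ x, q.liftBaseChange S (1 ⊗ₜ x) = q x := fun x => by simp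
    -- The R-linear cover `q` is extended to an S-linear cover, whose kernel is still resolved over
    -- R, so the step can be repeated.
    refine ⟨ModuleCat.of S (LinearMap.ker (q.liftBaseChange S)),
      ⟨ModuleCat.of S (S ⊗[R] (C →ₗ[R] J)), _, q.liftBaseChange S, h.injective_tensor hC J,
        ProperSES.of_ker ?_ (h.exists_lift_of_injective hC fun B hB φ => ?_)⟩,
      inferInstanceAs (Module R (LinearMap.ker (q.liftBaseChange S))),
      inferInstanceAs (IsScalarTower R S (LinearMap.ker (q.liftBaseChange S))),
      h.leftResolved_ker hC J hq hqK⟩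
    · intro n
      obtain ⟨x, rfl⟩ := hq.surj n
      exact ⟨1 ⊗ₜ x, hone x⟩
    · obtain ⟨ψ, rfl⟩ := hq.lift B hB φ
      refine ⟨TensorProduct.mk R S _ 1 ∘ₗ ψ, ?_⟩
      ext x
      exact hone (ψ x)

end

/-- The `R`-module `M` is regarded as an `S`-module via `g : S → R`. -/
theorem proposition3p12 (R : Type u) [CommRing R] [IsNoetherianRing R]
    (S : Type u) [CommRing S] [Algebra R S] (g : S →ₐ[R] R)
    (C : Type u) [AddCommGroup C] [Module R C]
    (hC : IsSemidualizing R C) (h : IsDualizingRetract R S g C) (M : ModuleCat.{u} R) :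
    IsCGorensteinInjective R C M ↔
      IsGorensteinInjective S ((ModuleCat.restrictScalars (g : S →+* R)).obj M) := by
  let N := (ModuleCat.restrictScalars (g : S →+* R)).obj M
  let _ : Module R N := inferInstanceAs (Module R M)
  have : IsScalarTower R S N := ⟨fun r s (x : M) => by
    change g (r • s) • x = r • g s • x
    rw [map_smul, smul_assoc]⟩
  have e : ModuleCat.of R N ≃ₗ[R] M := LinearEquiv.refl R M
  refine (exists_isCompleteResolution_iff M).trans
    (Iff.trans ?_ (exists_isCompleteResolution_iff N).symm)
  rw [h.leftResolved_iff hC N, h.rightResolved_iff hC N]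
  exact ⟨fun H => ⟨H.1.of_equiv e.symm, H.2.of_equiv e.symm⟩,
    fun H => ⟨H.1.of_equiv e, H.2.of_equiv e⟩⟩
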